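/- **Maximality of $S5_{\Box\Diamond}$, $5S_{\Box\Diamond}$ and trijunctions.** *Setting.* A *modality* is a finite (possibly empty) sequence of $\Box$ and $\Diamond$; $M$ ranges over $\{\Box,\Diamond\}$. Arrow terms $f\colon A\vdash B$ between modalities are built from primitive arrow terms, including $\mathbf 1_A\colon A\vdash A$, by composition $g\circ f$ and by the operations $f\colon A\vdash B\ \mapsto\ Mf\colon MA\vdash MB$. The objects of the categories below are the modalities, and the arrows are equivalence classes of arrow terms modulo the congruence generated by the categorial equations, the functorial equations $M\mathbf 1_A=\mathbf 1_{MA}$, $M(g\circ f)=Mg\circ Mf$, and the equations listed, for all $A$, $M$ and $f\colon A\vdash B$. $S5_{\Box\Diamond}$ has primitive arrow terms $\varepsilon^\Box_A\colon\Box A\vdash A$, $\varepsilon^\Diamond_A\colon A\vdash\Diamond A$, $\delta^{\Box M}_A\colon MA\vdash\Box MA$, $\delta^{\Diamond M}_A\colon\Diamond MA\vdash MA$, and the equations - $\varepsilon^\Box_B\circ\Box f=f\circ\varepsilon^\Box_A$, $\ \Diamond f\circ\varepsilon^\Diamond_A=\varepsilon^\Diamond_B\circ f$, $\ \Box Mf\circ\delta^{\Box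 M}_A=\delta^{\Box M}_B\circ Mf$, $\ \delta^{\Diamond M}_B\circ\Diamond Mf=Mf\circ\delta^{\Diamond M}_A$; - $\Box\delta^{\Box M}_A\circ\delta^{\Box M}_A=\delta^{\Box\Box}_{MA}\circ\delta^{\Box M}_A$, $\ \delta^{\Diamond M}_A\circ\Diamond\delta^{\Diamond M}_A=\delta^{\Diamond M}_A\circ\delta^{\Diamond\Diamond}_{MA}$; - $\varepsilon^\Box_{MA}\circ\delta^{\Box M}_A=\mathbf 1_{MA}$, $\ \delta^{\Diamond M}_A\circ\varepsilon^\Diamond_{MA}=\mathbf 1_{MA}$, $\ \Box\varepsilon^\Box_A\circ\delta^{\Box\Box}_A=\mathbf 1_{\Box A}$, $\ \delta^{\Diamond\Diamond}_A\circ\Diamond\varepsilon^\Diamond_A=\mathbf 1_{\Diamond A}$; - $\Box\delta^{\Diamond M}_A\circ\delta^{\Box\Diamond}_{MA}=\delta^{\Box M}_A\circ\delta^{\Diamond M}_A$, $\ \delta^{\Diamond\Box}_{MA}\circ\Diamond\delta^{\Box M}_A=\delta^{\Box M}_A\circ\delta^{\Diamond M}_A$. $5S_{\Box\Diamond}$ has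 primitive arrow terms $\varepsilon^\Box_A$, $\varepsilon^\Diamond_A$ as above, $\sigma^{M\Box}_A\colon MA\vdash M\Box A$, $\sigma^{M\Diamond}_A\colon M\Diamond A\vdash MA$, and the equations - the naturality equations of $\varepsilon^\Box$ and $\varepsilon^\Diamond$, $\ M\Box f\circ\sigma^{M\Box}_A=\sigma^{M\Box}_B\circ Mf$, $\ \sigma^{M\Diamond}_B\circ M\Diamond f=Mf\circ\sigma^{M\Diamond}_A$; - $\Box\sigma^{\Box\Box}_A\circ\sigma^{\Box\Box}_A=\sigma^{\Box\Box}_{\Box A}\circ\sigma^{\Box\Box}_A$, $\ \sigma^{\Diamond\Diamond}_A\circ\Diamond\sigma^{\Diamond\Diamond}_A=\sigma^{\Diamond\Diamond}_A\circ\sigma^{\Diamond\Diamond}_{\Diamond A}$; - $\varepsilon^\Box_{\Box A}\circ\sigma^{\Box\Box}_A=\mathbf 1_{\Box A}$, $\ \sigma^{\Diamond\Diamond}_A\circ\varepsilon^\Diamond_{\Diamond A}=\mathbf 1_{\Diamond A}$, $\ M\varepsilon^\Box_A\circ\sigma^{M\Box}_A=\mathbf 1_{MA}$, $\ \sigma^{M\Diamond}_A\circ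 M\varepsilon^\Diamond_A=\mathbf 1_{MA}$; - $M\sigma^{\Box\Diamond}_A\circ\sigma^{M\Box}_{\Diamond A}=\sigma^{M\Box}_A\circ\sigma^{M\Diamond}_A$, $\ \sigma^{M\Diamond}_{\Box A}\circ M\sigma^{\Diamond\Box}_A=\sigma^{M\Box}_A\circ\sigma^{M\Diamond}_A$. To assume an equation between arrow terms *universally* means to assume, for every modality $C$, the equation obtained by appending $C$ on the right to all subscripts of primitive arrow terms. A category is a *preorder* if any two arrows with the same source and the same target are equal. The *preordering equations* of $S5_{\Box\Diamond}$ are $$\Box\varepsilon^\Box_A=\varepsilon^\Box_{\Box A},\qquad \varepsilon^\Box_A\circ\varepsilon^\Box_{\Box A}\circ\delta^{\Diamond\Box}_{\Box A}=\varepsilon^\Box_A\circ\delta^{\Diamond\Box}_A\circ\Diamond\varepsilon^\Box_{\Box A},$$ $$\Box\varepsilon^\Diamond_A=\delta^{\Box\Diamond}_A\circ\varepsilon^\Diamond_A\circ\varepsilon^\Box_A,\qquad \varepsilon^\Diamond_A\circ\varepsilon^\Box_A\circ\delta^{\Diamond\Box}_A=\Diamond\varepsilon^\Box_A,$$ $$\Box\varepsilon^\Diamond_{\Diamond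 A}\circ\delta^{\Box\Diamond}_A\circ\varepsilon^\Diamond_A=\delta^{\Box\Diamond}_{\Diamond A}\circ\varepsilon^\Diamond_{\Diamond A}\circ\varepsilon^\Diamond_A,\qquad \varepsilon^\Diamond_{\Diamond A}=\Diamond\varepsilon^\Diamond_A,$$ and those of $5S_{\Box\Diamond}$ are their mirror images $$\Box\varepsilon^\Box_A=\varepsilon^\Box_{\Box A},\qquad \varepsilon^\Box_A\circ\Box\varepsilon^\Box_A\circ\Box\sigma^{\Box\Diamond}_A=\varepsilon^\Box_A\circ\sigma^{\Box\Diamond}_A\circ\Box\varepsilon^\Box_{\Diamond A},$$ $$\varepsilon^\Diamond_{\Box A}=\sigma^{\Diamond\Box}_A\circ\varepsilon^\Diamond_A\circ\varepsilon^\Box_A,\qquad \varepsilon^\Diamond_A\circ\varepsilon^\Box_A\circ\sigma^{\Box\Diamond}_A=\varepsilon^\Box_{\Diamond A},$$ $$\Diamond\varepsilon^\Diamond_{\Box A}\circ\sigma^{\Diamond\Box}_A\circ\varepsilon^\Diamond_A=\Diamond\sigma^{\Diamond\Box}_A\circ\Diamond\varepsilon^\Diamond_A\circ\varepsilon^\Diamond_A,\qquad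 \varepsilon^\Diamond_{\Diamond A}=\Diamond\varepsilon^\Diamond_A.$$ $S5_{\Box\Diamond triv}$ (respectively $5S_{\Box\Diamond triv}$) is $S5_{\Box\Diamond}$ (respectively $5S_{\Box\Diamond}$) with one of its preordering equations added for all $A$; the choice is arbitrary. A *trijunction* consists of categories $\mathcal A,\mathcal B$, a functor $U\colon\mathcal A\to\mathcal B$ and functors $L,R\colon\mathcal B\to\mathcal A$ with $L$ left adjoint and $R$ right adjoint to $U$. Its *canonical functors* are the formal composites of $U,L,R$ (including the two identities). Its *canonical arrow terms* $f\colon X\vdash Y$, for canonical functors $X,Y$ with a common source and a common target, are built from identities and the members of the units and counits of the two adjunctions, taken at canonical functors, by composition and by applying $U,L,R$. The equations that hold are those derivable from the categorial and functorial equations, naturality of the units and counits, and the four triangular equations. To assume an equation between such terms *universally* means to assume also all equations obtained from it by composing with a canonical functor on the right. *Statement.* 1. Each of the six choices for $S5_{\Box\Diamond triv}$ yields a preorder. Let $f,g\colon A\vdash B$ be any arrow terms of $S5_{\Box\Diamond}$ such that $f=g$ does not hold in $S5_{\Box\Diamond}$. Then the extension of $S5_{\Box\Diamond}$ by $f=g$,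 universally assumed, is $S5_{\Box\Diamond triv}$ for each of the six choices, i.e. the same equations between arrow terms hold; in particular it is a preorder. 2. The same holds for $5S_{\Box\Diamond}$ and $5S_{\Box\Diamond triv}$. 3. If $f,g\colon X\vdash Y$ are canonical arrow terms of trijunctions such that $f=g$ is not derivable, then, when $f=g$ is universally assumed, every equation between canonical arrow terms of the same type is derivable. -/

import Mathlib

open CategoryTheory

namespace Modal

/-! ### Modalities, arrow terms and equational theories -/

/-- The two modal operators. -/
inductive Mod : Type
  | box : Mod
  | dia : Mod

/-- Modalities: finite, possibly empty, sequences of `box` and `dia`. -/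
abbrev Modality : Type := List Mod

/-- Arrow terms over a family `P` of primitive arrow terms: `P A B` is the type of the primitive
arrow terms with source `A` and target `B`, other than the identities. -/
inductive Term (P : Modality → Modality → Type) : Modality → Modality → Type
  | id (A : Modality) : Term P A A
  | prim {A B : Modality} (p : P A B) : Term P A B
  | comp {A B C : Modality} (g : Term P B C) (f : Term P A B) : Term P A C
  | map (M : Mod) {A B : Modality} (f : Term P A B) : Term P (M :: A) (M :: B)

/-- Composition of arrow terms; `g ⊚ f` is `g` after `f`. -/
infixr:80 " ⊚ " => Term.comp

/-- Sets of equations between arrow terms of the same type. -/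
abbrev EqSet (P : Modality → Modality → Type) : Type :=
  ∀ ⦃A B : Modality⦄, Term P A B → Term P A B → Prop

/-- The equations that hold in the category axiomatized by `R`: those derivable from `R` and the
categorial and functorial equations. -/
inductive Derives {P : Modality → Modality → Type} (R : EqSet P) :
    ∀ {A B : Modality}, Term P A B → Term P A B → Prop
  | ax {A B : Modality} {f g : Term P A B} : R f g → Derives R f g
  | refl {A B : Modality} (f : Term P A B) : Derives R f f
  | symm {A B : Modality} {f g : Term P A B} : Derives R f g → Derives R g f
  | trans {A B : Modality} {f g h : Term P A B} :
      Derives R f g → Derives R g h → Derives R f h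
  | comp_congr {A B C : Modality} {g g' : Term P B C} {f f' : Term P A B} :
      Derives R g g' → Derives R f f' → Derives R (g ⊚ f) (g' ⊚ f')
  | map_congr (M : Mod) {A B : Modality} {f g : Term P A B} :
      Derives R f g → Derives R (Term.map M f) (Term.map M g)
  | comp_id {A B : Modality} (f : Term P A B) : Derives R (f ⊚ Term.id A) f
  | id_comp {A B : Modality} (f : Term P A B) : Derives R (Term.id B ⊚ f) f
  | assoc {A B C D : Modality} (h : Term P C D) (g : Term P B C) (f : Term P A B) :
      Derives R (h ⊚ (g ⊚ f)) ((h ⊚ g) ⊚ f)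
  | map_id (M : Mod) (A : Modality) : Derives R (Term.map M (Term.id A)) (Term.id (M :: A))
  | map_comp (M : Mod) {A B C : Modality} (g : Term P B C) (f : Term P A B) :
      Derives R (Term.map M (g ⊚ f)) (Term.map M g ⊚ Term.map M f)

/-- Derivable equality, as an equivalence relation on arrow terms of a given type. -/
def derivesSetoid {P : Modality → Modality → Type} (R : EqSet P) (A B : Modality) :
    Setoid (Term P A B) where
  r f g := Derives R f g
  iseqv := ⟨Derives.refl, Derives.symm, Derives.trans⟩

/-- The category axiomatized by `R`: its objects are the modalities. -/
@[ext]
structure SynCat {P : Modality → Modality → Type} (R : EqSet P) : Type where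
  obj : Modality

/-- The arrow denoted by an arrow term in the category axiomatized by `R`. -/
def arrow {P : Modality → Modality → Type} (R : EqSet P) {A B : Modality} (f : Term P A B) :
    Quotient (derivesSetoid R A B) :=
  Quotient.mk _ f

/-- Arrows are equivalence classes of arrow terms modulo derivable equality. -/
instance {P : Modality → Modality → Type} (R : EqSet P) : Category (SynCat R) where
  Hom A B := Quotient (derivesSetoid R A.obj B.obj)
  id A := arrow R (Term.id A.obj)
  comp {_ _ _} f g := Quotient.map₂ (fun f g => g ⊚ f)
    (fun _ _ hf _ _ hg => Derives.comp_congr hg hf) f g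
  id_comp {A B} f := by
    induction f using Quotient.inductionOn with
    | h f => exact Quotient.sound (Derives.comp_id f)
  comp_id {A B} f := by
    induction f using Quotient.inductionOn with
    | h f => exact Quotient.sound (Derives.id_comp f)
  assoc {A B C D} f g h := by
    induction f using Quotient.inductionOn with
    | h f =>
      induction g using Quotient.inductionOn with
      | h g =>
        induction h using Quotient.inductionOn with
        | h h => exact Quotient.sound (Derives.assoc h g f)

/-- Two axiomatizations define the same category: the same equations between arrow terms hold. -/
def SameCategory {P : Modality → Modality → Type} (R R' : EqSet P) : Prop :=
  ∀ (A B : Modality) (h k : Term P A B), arrow R h = arrow R k ↔ arrow R' h = arrow R' k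

/-- Adding the equations of `S` to those of `R`. -/
def EqSet.extend {P : Modality → Modality → Type} (R S : EqSet P) : EqSet P :=
  fun _ _ h k => R h k ∨ S h k

/-- Appending `C` on the right to the subscripts of all the primitive arrow terms in an arrow
term, given this operation `sh` on the primitive arrow terms other than identities. -/
def Term.append {P : Modality → Modality → Type}
    (sh : ∀ (C : Modality) {A B : Modality}, P A B → P (A ++ C) (B ++ C)) (C : Modality) :
    ∀ {A B : Modality}, Term P A B → Term P (A ++ C) (B ++ C)
  | _, _, .id A => .id (A ++ C)
  | _, _, .prim p => .prim (sh C p)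
  | _, _, .comp g f => .comp (g.append sh C) (f.append sh C)
  | _, _, .map M f => .map M (f.append sh C)

/-- The equation `f = g` universally assumed: all equations obtained from it by appending a
modality on the right to the subscripts. -/
inductive Universal {P : Modality → Modality → Type}
    (sh : ∀ (C : Modality) {A B : Modality}, P A B → P (A ++ C) (B ++ C))
    {A B : Modality} (f g : Term P A B) : EqSet P
  | inst (C : Modality) : Universal sh f g (f.append sh C) (g.append sh C)

/-! ### The category `S5` -/

namespace S5

/-- Primitive arrow terms. `delBox M A` has the superscript `box M`, and `delDia M A` the
superscript `dia M`. -/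
inductive Prim : Modality → Modality → Type
  | epsBox (A : Modality) : Prim (.box :: A) A
  | epsDia (A : Modality) : Prim A (.dia :: A)
  | delBox (M : Mod) (A : Modality) : Prim (M :: A) (.box :: M :: A)
  | delDia (M : Mod) (A : Modality) : Prim (.dia :: M :: A) (M :: A)

/-- Appending a modality to the subscript of a primitive arrow term. -/
def Prim.shift (C : Modality) : ∀ {A B : Modality}, Prim A B → Prim (A ++ C) (B ++ C)
  | _, _, .epsBox A => .epsBox (A ++ C)
  | _, _, .epsDia A => .epsDia (A ++ C)
  | _, _, .delBox M A => .delBox M (A ++ C)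
  | _, _, .delDia M A => .delDia M (A ++ C)

abbrev epsBox (A : Modality) : Term Prim (.box :: A) A := .prim (.epsBox A)
abbrev epsDia (A : Modality) : Term Prim A (.dia :: A) := .prim (.epsDia A)
abbrev delBox (M : Mod) (A : Modality) : Term Prim (M :: A) (.box :: M :: A) :=
  .prim (.delBox M A)
abbrev delDia (M : Mod) (A : Modality) : Term Prim (.dia :: M :: A) (M :: A) :=
  .prim (.delDia M A)

/-- The axiomatic equations, besides the categorial and functorial ones. -/
inductive Ax : EqSet Prim
  | epsBox_nat {A B : Modality} (f : Term Prim A B) :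
      Ax (epsBox B ⊚ .map .box f) (f ⊚ epsBox A)
  | epsDia_nat {A B : Modality} (f : Term Prim A B) :
      Ax (.map .dia f ⊚ epsDia A) (epsDia B ⊚ f)
  | delBox_nat (M : Mod) {A B : Modality} (f : Term Prim A B) :
      Ax (.map .box (.map M f) ⊚ delBox M A) (delBox M B ⊚ .map M f)
  | delDia_nat (M : Mod) {A B : Modality} (f : Term Prim A B) :
      Ax (delDia M B ⊚ .map .dia (.map M f)) (.map M f ⊚ delDia M A)
  | delBox_delBox (M : Mod) (A : Modality) :
      Ax (.map .box (delBox M A) ⊚ delBox M A) (delBox .box (M :: A) ⊚ delBox M A)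
  | delDia_delDia (M : Mod) (A : Modality) :
      Ax (delDia M A ⊚ .map .dia (delDia M A)) (delDia M A ⊚ delDia .dia (M :: A))
  | box_beta (M : Mod) (A : Modality) :
      Ax (epsBox (M :: A) ⊚ delBox M A) (.id (M :: A))
  | dia_beta (M : Mod) (A : Modality) :
      Ax (delDia M A ⊚ epsDia (M :: A)) (.id (M :: A))
  | box_eta (A : Modality) :
      Ax (.map .box (epsBox A) ⊚ delBox .box A) (.id (.box :: A))
  | dia_eta (A : Modality) :
      Ax (delDia .dia A ⊚ .map .dia (epsDia A)) (.id (.dia :: A))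
  | frob_N (M : Mod) (A : Modality) :
      Ax (.map .box (delDia M A) ⊚ delBox .dia (M :: A)) (delBox M A ⊚ delDia M A)
  | frob_I (M : Mod) (A : Modality) :
      Ax (delDia .box (M :: A) ⊚ .map .dia (delBox M A)) (delBox M A ⊚ delDia M A)

/-- The six preordering equations, each universally assumed. -/
inductive Preordering : Fin 6 → EqSet Prim
  | e0 (A : Modality) : Preordering 0
      (.map .box (epsBox A))
      (epsBox (.box :: A))
  | e1 (A : Modality) : Preordering 1
      (epsBox A ⊚ epsBox (.box :: A) ⊚ delDia .box (.box :: A))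
      (epsBox A ⊚ delDia .box A ⊚ .map .dia (epsBox (.box :: A)))
  | e2 (A : Modality) : Preordering 2
      (.map .box (epsDia A))
      (delBox .dia A ⊚ epsDia A ⊚ epsBox A)
  | e3 (A : Modality) : Preordering 3
      (epsDia A ⊚ epsBox A ⊚ delDia .box A)
      (.map .dia (epsBox A))
  | e4 (A : Modality) : Preordering 4
      (.map .box (epsDia (.dia :: A)) ⊚ delBox .dia A ⊚ epsDia A)
      (delBox .dia (.dia :: A) ⊚ epsDia (.dia :: A) ⊚ epsDia A)
  | e5 (A : Modality) : Preordering 5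
      (epsDia (.dia :: A))
      (.map .dia (epsDia A))

/-- `S5` extended with the `i`-th preordering equation. -/
def Triv (i : Fin 6) : EqSet Prim := EqSet.extend Ax (Preordering i)

/-- `S5` extended with `f = g`, universally assumed. -/
def Ext {A B : Modality} (f g : Term Prim A B) : EqSet Prim :=
  EqSet.extend Ax (Universal Prim.shift f g)

end S5

/-! ### The category `5S` (the mirror image of `S5`) -/

namespace FiveS

/-- Primitive arrow terms. `sigBox M A` has the superscript `M box`, and `sigDia M A` the
superscript `M dia`. -/
inductive Prim : Modality → Modality → Type
  | epsBox (A : Modality) : Prim (.box :: A) A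
  | epsDia (A : Modality) : Prim A (.dia :: A)
  | sigBox (M : Mod) (A : Modality) : Prim (M :: A) (M :: .box :: A)
  | sigDia (M : Mod) (A : Modality) : Prim (M :: .dia :: A) (M :: A)

/-- Appending a modality to the subscript of a primitive arrow term. -/
def Prim.shift (C : Modality) : ∀ {A B : Modality}, Prim A B → Prim (A ++ C) (B ++ C)
  | _, _, .epsBox A => .epsBox (A ++ C)
  | _, _, .epsDia A => .epsDia (A ++ C)
  | _, _, .sigBox M A => .sigBox M (A ++ C)
  | _, _, .sigDia M A => .sigDia M (A ++ C)

abbrev epsBox (A : Modality) : Term Prim (.box :: A) A := .prim (.epsBox A)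
abbrev epsDia (A : Modality) : Term Prim A (.dia :: A) := .prim (.epsDia A)
abbrev sigBox (M : Mod) (A : Modality) : Term Prim (M :: A) (M :: .box :: A) :=
  .prim (.sigBox M A)
abbrev sigDia (M : Mod) (A : Modality) : Term Prim (M :: .dia :: A) (M :: A) :=
  .prim (.sigDia M A)

/-- The axiomatic equations, besides the categorial and functorial ones. -/
inductive Ax : EqSet Prim
  | epsBox_nat {A B : Modality} (f : Term Prim A B) :
      Ax (epsBox B ⊚ .map .box f) (f ⊚ epsBox A)
  | epsDia_nat {A B : Modality} (f : Term Prim A B) :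
      Ax (.map .dia f ⊚ epsDia A) (epsDia B ⊚ f)
  | sigBox_nat (M : Mod) {A B : Modality} (f : Term Prim A B) :
      Ax (.map M (.map .box f) ⊚ sigBox M A) (sigBox M B ⊚ .map M f)
  | sigDia_nat (M : Mod) {A B : Modality} (f : Term Prim A B) :
      Ax (sigDia M B ⊚ .map M (.map .dia f)) (.map M f ⊚ sigDia M A)
  | sigBox_sigBox (A : Modality) :
      Ax (.map .box (sigBox .box A) ⊚ sigBox .box A) (sigBox .box (.box :: A) ⊚ sigBox .box A)
  | sigDia_sigDia (A : Modality) :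
      Ax (sigDia .dia A ⊚ .map .dia (sigDia .dia A)) (sigDia .dia A ⊚ sigDia .dia (.dia :: A))
  | box_beta (A : Modality) :
      Ax (epsBox (.box :: A) ⊚ sigBox .box A) (.id (.box :: A))
  | dia_beta (A : Modality) :
      Ax (sigDia .dia A ⊚ epsDia (.dia :: A)) (.id (.dia :: A))
  | box_eta (M : Mod) (A : Modality) :
      Ax (.map M (epsBox A) ⊚ sigBox M A) (.id (M :: A))
  | dia_eta (M : Mod) (A : Modality) :
      Ax (sigDia M A ⊚ .map M (epsDia A)) (.id (M :: A))
  | frob_N (M : Mod) (A : Modality) :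
      Ax (.map M (sigDia .box A) ⊚ sigBox M (.dia :: A)) (sigBox M A ⊚ sigDia M A)
  | frob_I (M : Mod) (A : Modality) :
      Ax (sigDia M (.box :: A) ⊚ .map M (sigBox .dia A)) (sigBox M A ⊚ sigDia M A)

/-- The six preordering equations, mirror images of those of `S5`, each universally assumed. -/
inductive Preordering : Fin 6 → EqSet Prim
  | e0 (A : Modality) : Preordering 0
      (.map .box (epsBox A))
      (epsBox (.box :: A))
  | e1 (A : Modality) : Preordering 1
      (epsBox A ⊚ .map .box (epsBox A) ⊚ .map .box (sigDia .box A))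
      (epsBox A ⊚ sigDia .box A ⊚ .map .box (epsBox (.dia :: A)))
  | e2 (A : Modality) : Preordering 2
      (epsDia (.box :: A))
      (sigBox .dia A ⊚ epsDia A ⊚ epsBox A)
  | e3 (A : Modality) : Preordering 3
      (epsDia A ⊚ epsBox A ⊚ sigDia .box A)
      (epsBox (.dia :: A))
  | e4 (A : Modality) : Preordering 4
      (.map .dia (epsDia (.box :: A)) ⊚ sigBox .dia A ⊚ epsDia A)
      (.map .dia (sigBox .dia A) ⊚ .map .dia (epsDia A) ⊚ epsDia A)
  | e5 (A : Modality) : Preordering 5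
      (epsDia (.dia :: A))
      (.map .dia (epsDia A))

/-- `5S` extended with the `i`-th preordering equation. -/
def Triv (i : Fin 6) : EqSet Prim := EqSet.extend Ax (Preordering i)

/-- `5S` extended with `f = g`, universally assumed. -/
def Ext {A B : Modality} (f g : Term Prim A B) : EqSet Prim :=
  EqSet.extend Ax (Universal Prim.shift f g)

end FiveS

/-! ### Trijunctions: functors `L`, `R` from `b` to `a`, and `U` from `a` to `b`, with `L` left
adjoint and `R` right adjoint to `U`, in their canonical language -/

namespace Trijunction

/-- The two categories of a trijunction. -/
inductive Side : Type
  | a : Side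
  | b : Side

/-- The three functors of a trijunction, with their source and target categories. -/
inductive Fn : Side → Side → Type
  | U : Fn .a .b
  | L : Fn .b .a
  | R : Fn .b .a

/-- Canonical functors from `s` to `t`: composites of `U`, `L`, `R`, the outermost one first. -/
inductive Word (s : Side) : Side → Type
  | nil : Word s s
  | cons {t u : Side} (F : Fn t u) (X : Word s t) : Word s u

/-- Composition of canonical functors. -/
def Word.append {r s : Side} : ∀ {t : Side}, Word s t → Word r s → Word r t
  | _, .nil, Z => Z
  | _, .cons F X, Z => .cons F (X.append Z)

/-- Canonical arrow terms between canonical functors; `phiL`, `phiR` are the counits and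
`gammaL`, `gammaR` the units of the two adjunctions. -/
inductive Arr {s : Side} : ∀ {t : Side}, Word s t → Word s t → Type
  | id {t : Side} (X : Word s t) : Arr X X
  | comp {t : Side} {X Y Z : Word s t} (g : Arr Y Z) (f : Arr X Y) : Arr X Z
  | map {t u : Side} (F : Fn t u) {X Y : Word s t} (f : Arr X Y) : Arr (.cons F X) (.cons F Y)
  | phiL (X : Word s .a) : Arr (.cons .L (.cons .U X)) X
  | gammaL (X : Word s .b) : Arr X (.cons .U (.cons .L X))
  | phiR (X : Word s .b) : Arr (.cons .U (.cons .R X)) X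
  | gammaR (X : Word s .a) : Arr X (.cons .R (.cons .U X))

/-- Composing a canonical arrow term with a canonical functor on the right. -/
def Arr.append {r s : Side} :
    ∀ {t : Side} {X Y : Word s t}, Arr X Y → ∀ Z : Word r s, Arr (X.append Z) (Y.append Z)
  | _, _, _, .id X, Z => .id (X.append Z)
  | _, _, _, .comp g f, Z => .comp (g.append Z) (f.append Z)
  | _, _, _, .map F f, Z => .map F (f.append Z)
  | _, _, _, .phiL X, Z => .phiL (X.append Z)
  | _, _, _, .gammaL X, Z => .gammaL (X.append Z)
  | _, _, _, .phiR X, Z => .phiR (X.append Z)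
  | _, _, _, .gammaR X, Z => .gammaR (X.append Z)

/-- Sets of equations between canonical arrow terms of the same type. -/
abbrev ArrEqSet : Type :=
  ∀ ⦃s t : Side⦄ ⦃X Y : Word s t⦄, Arr X Y → Arr X Y → Prop

/-- The equation `f = g` universally assumed. -/
inductive Universal {s t : Side} {X Y : Word s t} (f g : Arr X Y) : ArrEqSet
  | inst {r : Side} (Z : Word r s) : Universal f g (f.append Z) (g.append Z)

/-- The equations derivable from `E` and the axioms of trijunctions. -/
inductive Derives (E : ArrEqSet) :
    ∀ {s t : Side} {X Y : Word s t}, Arr X Y → Arr X Y → Prop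
  | ax {s t : Side} {X Y : Word s t} {f g : Arr X Y} : E f g → Derives E f g
  | refl {s t : Side} {X Y : Word s t} (f : Arr X Y) : Derives E f f
  | symm {s t : Side} {X Y : Word s t} {f g : Arr X Y} : Derives E f g → Derives E g f
  | trans {s t : Side} {X Y : Word s t} {f g h : Arr X Y} :
      Derives E f g → Derives E g h → Derives E f h
  | comp_congr {s t : Side} {X Y Z : Word s t} {g g' : Arr Y Z} {f f' : Arr X Y} :
      Derives E g g' → Derives E f f' → Derives E (g.comp f) (g'.comp f')
  | map_congr {s t u : Side} (F : Fn t u) {X Y : Word s t} {f g : Arr X Y} :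
      Derives E f g → Derives E (Arr.map F f) (Arr.map F g)
  | comp_id {s t : Side} {X Y : Word s t} (f : Arr X Y) : Derives E (f.comp (.id X)) f
  | id_comp {s t : Side} {X Y : Word s t} (f : Arr X Y) : Derives E ((Arr.id Y).comp f) f
  | assoc {s t : Side} {W X Y Z : Word s t} (h : Arr Y Z) (g : Arr X Y) (f : Arr W X) :
      Derives E (h.comp (g.comp f)) ((h.comp g).comp f)
  | map_id {s t u : Side} (F : Fn t u) (X : Word s t) :
      Derives E (Arr.map F (.id X)) (.id (.cons F X))
  | map_comp {s t u : Side} (F : Fn t u) {X Y Z : Word s t} (g : Arr Y Z) (f : Arr X Y) :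
      Derives E (Arr.map F (g.comp f)) ((Arr.map F g).comp (Arr.map F f))
  | phiL_nat {s : Side} {X Y : Word s .a} (f : Arr X Y) :
      Derives E ((Arr.phiL Y).comp (.map .L (.map .U f))) (f.comp (.phiL X))
  | gammaL_nat {s : Side} {X Y : Word s .b} (f : Arr X Y) :
      Derives E ((Arr.map .U (.map .L f)).comp (.gammaL X)) ((Arr.gammaL Y).comp f)
  | phiR_nat {s : Side} {X Y : Word s .b} (f : Arr X Y) :
      Derives E ((Arr.phiR Y).comp (.map .U (.map .R f))) (f.comp (.phiR X))
  | gammaR_nat {s : Side} {X Y : Word s .a} (f : Arr X Y) :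
      Derives E ((Arr.map .R (.map .U f)).comp (.gammaR X)) ((Arr.gammaR Y).comp f)
  | triangle_L {s : Side} (X : Word s .b) :
      Derives E ((Arr.phiL (.cons .L X)).comp (.map .L (.gammaL X))) (.id (.cons .L X))
  | triangle_UL {s : Side} (X : Word s .a) :
      Derives E ((Arr.map .U (.phiL X)).comp (.gammaL (.cons .U X))) (.id (.cons .U X))
  | triangle_UR {s : Side} (X : Word s .a) :
      Derives E ((Arr.phiR (.cons .U X)).comp (.map .U (.gammaR X))) (.id (.cons .U X))
  | triangle_R {s : Side} (X : Word s .b) :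
      Derives E ((Arr.map .R (.phiR X)).comp (.gammaR (.cons .R X))) (.id (.cons .R X))

/-- The equations holding in every trijunction: no equation is added. -/
def Free : ArrEqSet := fun _ _ _ _ _ _ => False

end Trijunction

end Modal

/-!
Everything reduces to trijunctions `L ⊣ U ⊣ R`: the modalities of `S5` are the canonical functors
from `b` to `b`, with `box = U R` and `dia = U L`, and those of `5S` are the canonical functors from
`a` to `a`, with `box = L U` and `dia = R U`. Arrow terms are translated both ways (`S5.toArr`,
`S5.ofArr`, `FiveS.toArr`, `FiveS.ofArr`), and the translations preserve derivable equality
(`S5.derives_ofArr`, `FiveS.derives_ofArr`) and universal closure (`ofArr_append_toArr`).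

A canonical arrow is a planar matching of the letters of its source and target. Its normal form
(`NF`) is a composite `c ⊙ e`, where `e`, built with counits (`Cap`), contracts the pairs matched
within the source, and `c`, built with units (`Cup`), creates those matched within the target. That
every arrow has a normal form (`exists_nf`) rests on moving counits before units
(`exists_interchange`). It remains to see that identifying two distinct normal forms identifies all
parallel arrows. Composing with `U` on the left and with a functor on the right keeps normal forms
distinct and brings `U` to both ends of all words; then counit parts have sections and unit parts
have retractions. If `c ⊙ e` and `c' ⊙ e'` are identified, the sections and retractions make their
middle words isomorphic. Either the isomorphism is nontrivial, and some split epimorphism `U φL` or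
`φR U` becomes invertible (`Cap.collapse_of_retraction`), or `e` is identified with `e'` and `c` with
`c'`, and again such an inverse is found where their codes first differ (`Cap.collapse_or_eq`,
`Cup.collapse_or_eq`). Invertibility of `U φL` and of `φR U` follow from each other; together they
contract every word ending in `b` to one of four, between which there is at most one normal form
(`Collapse.hom_subsingleton`).

For the six preordering equations it is enough that they do not hold already. This is seen in a
model in which an arrow denotes the relation of equality of truth values on matched letters (`sem`).
-/

open CategoryTheory

namespace Modal
namespace Trijunction

/-! ### Canonical arrows -/

variable {s t u : Side}

/-- Derivable equality of canonical arrow terms, as an equivalence relation. -/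
def arrSetoid (E : ArrEqSet) (X Y : Word s t) : Setoid (Arr X Y) where
  r f g := Derives E f g
  iseqv := ⟨Derives.refl, Derives.symm, Derives.trans⟩

/-- Canonical arrows: canonical arrow terms modulo the equations derivable from `E`. -/
def Hom (E : ArrEqSet) (X Y : Word s t) : Type := Quotient (arrSetoid E X Y)

/-- The canonical arrow denoted by a canonical arrow term. -/
def mk (E : ArrEqSet) {X Y : Word s t} (f : Arr X Y) : Hom E X Y := Quotient.mk _ f

theorem mk_eq_mk {E : ArrEqSet} {X Y : Word s t} {f g : Arr X Y} :
    mk E f = mk E g ↔ Derives E f g :=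
  ⟨fun h => Quotient.exact h, fun h => Quotient.sound h⟩

theorem exists_mk {E : ArrEqSet} {X Y : Word s t} (f : Hom E X Y) : ∃ f₀, mk E f₀ = f :=
  Quotient.exists_rep f

namespace Hom

variable {E : ArrEqSet}

/-- The identity arrow of a canonical functor. -/
def id (E : ArrEqSet) (X : Word s t) : Hom E X X := mk E (.id X)

/-- Composition of canonical arrows: `g` after `f`. -/
def comp {X Y Z : Word s t} (g : Hom E Y Z) (f : Hom E X Y) : Hom E X Z :=
  Quotient.map₂ Arr.comp (fun _ _ hg _ _ hf => Derives.comp_congr hg hf) g f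

/-- Application of one of the functors `U`, `L`, `R` to a canonical arrow. -/
def map (F : Fn t u) {X Y : Word s t} (f : Hom E X Y) : Hom E (.cons F X) (.cons F Y) :=
  Quotient.map (Arr.map F) (fun _ _ hf => Derives.map_congr F hf) f

/-- The counit of `L ⊣ U`. -/
def pL (X : Word s .a) : Hom E (.cons .L (.cons .U X)) X := mk E (.phiL X)
/-- The unit of `L ⊣ U`. -/
def gL (X : Word s .b) : Hom E X (.cons .U (.cons .L X)) := mk E (.gammaL X)
/-- The counit of `U ⊣ R`. -/
def pR (X : Word s .b) : Hom E (.cons .U (.cons .R X)) X := mk E (.phiR X)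
/-- The unit of `U ⊣ R`. -/
def gR (X : Word s .a) : Hom E X (.cons .R (.cons .U X)) := mk E (.gammaR X)

end Hom

/-- Composition of canonical arrows; `g ⊙ f` is `g` after `f`. -/
infixr:80 " ⊙ " => Hom.comp

open Hom

variable {E : ArrEqSet}

theorem mk_id (X : Word s t) : mk E (.id X) = Hom.id E X := rfl
theorem mk_comp {X Y Z : Word s t} (g : Arr Y Z) (f : Arr X Y) :
    mk E (g.comp f) = mk E g ⊙ mk E f := rfl
theorem mk_map (F : Fn t u) {X Y : Word s t} (f : Arr X Y) :
    mk E (.map F f) = Hom.map F (mk E f) := rfl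
theorem mk_phiL (X : Word s .a) : mk E (.phiL X) = pL X := rfl
theorem mk_gammaL (X : Word s .b) : mk E (.gammaL X) = gL X := rfl
theorem mk_phiR (X : Word s .b) : mk E (.phiR X) = pR X := rfl
theorem mk_gammaR (X : Word s .a) : mk E (.gammaR X) = gR X := rfl

/-! ### Equational reasoning in trijunctions -/

-- Oriented as rewriting rules, naturality moves counits to the right and units to the left of a
-- composite.

@[simp] theorem comp_id {X Y : Word s t} (f : Hom E X Y) : f ⊙ Hom.id E X = f := by
  obtain ⟨f, rfl⟩ := exists_mk f
  exact mk_eq_mk.2 (.comp_id f)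

@[simp] theorem id_comp {X Y : Word s t} (f : Hom E X Y) : Hom.id E Y ⊙ f = f := by
  obtain ⟨f, rfl⟩ := exists_mk f
  exact mk_eq_mk.2 (.id_comp f)

@[simp] theorem assoc {W X Y Z : Word s t} (h : Hom E Y Z) (g : Hom E X Y) (f : Hom E W X) :
    (h ⊙ g) ⊙ f = h ⊙ g ⊙ f := by
  obtain ⟨f, rfl⟩ := exists_mk f
  obtain ⟨g, rfl⟩ := exists_mk g
  obtain ⟨h, rfl⟩ := exists_mk h
  exact (mk_eq_mk.2 (.assoc h g f)).symm

@[simp] theorem map_id (F : Fn t u) (X : Word s t) :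
    Hom.map F (Hom.id E X) = Hom.id E (.cons F X) :=
  mk_eq_mk.2 (.map_id F X)

@[simp] theorem map_comp (F : Fn t u) {X Y Z : Word s t} (g : Hom E Y Z) (f : Hom E X Y) :
    Hom.map F (g ⊙ f) = Hom.map F g ⊙ Hom.map F f := by
  obtain ⟨f, rfl⟩ := exists_mk f
  obtain ⟨g, rfl⟩ := exists_mk g
  exact mk_eq_mk.2 (.map_comp F g f)

@[simp] theorem pL_nat {X Y : Word s .a} (f : Hom E X Y) :
    pL Y ⊙ Hom.map .L (Hom.map .U f) = f ⊙ pL X := by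
  obtain ⟨f, rfl⟩ := exists_mk f
  exact mk_eq_mk.2 (.phiL_nat f)

@[simp] theorem gL_nat {X Y : Word s .b} (f : Hom E X Y) :
    Hom.map .U (Hom.map .L f) ⊙ gL X = gL Y ⊙ f := by
  obtain ⟨f, rfl⟩ := exists_mk f
  exact mk_eq_mk.2 (.gammaL_nat f)

@[simp] theorem pR_nat {X Y : Word s .b} (f : Hom E X Y) :
    pR Y ⊙ Hom.map .U (Hom.map .R f) = f ⊙ pR X := by
  obtain ⟨f, rfl⟩ := exists_mk f
  exact mk_eq_mk.2 (.phiR_nat f)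

@[simp] theorem gR_nat {X Y : Word s .a} (f : Hom E X Y) :
    Hom.map .R (Hom.map .U f) ⊙ gR X = gR Y ⊙ f := by
  obtain ⟨f, rfl⟩ := exists_mk f
  exact mk_eq_mk.2 (.gammaR_nat f)

@[simp] theorem tri_L (X : Word s .b) :
    pL (.cons .L X) ⊙ Hom.map .L (gL X) = Hom.id E _ :=
  mk_eq_mk.2 (.triangle_L X)

@[simp] theorem tri_UL (X : Word s .a) :
    Hom.map .U (pL X) ⊙ gL (.cons .U X) = Hom.id E _ :=
  mk_eq_mk.2 (.triangle_UL X)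

@[simp] theorem tri_UR (X : Word s .a) :
    pR (.cons .U X) ⊙ Hom.map .U (gR X) = Hom.id E _ :=
  mk_eq_mk.2 (.triangle_UR X)

@[simp] theorem tri_R (X : Word s .b) :
    Hom.map .R (pR X) ⊙ gR (.cons .R X) = Hom.id E _ :=
  mk_eq_mk.2 (.triangle_R X)

section Reassoc

/-- A composite equation, composed with an arrow on the right. -/
theorem comp_of_eq {W X Y Z : Word s t} {g : Hom E Y Z} {f : Hom E X Y} {h : Hom E X Z}
    (e : g ⊙ f = h) (k : Hom E W X) : g ⊙ f ⊙ k = h ⊙ k := by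
  rw [← assoc, e]

@[simp] theorem pL_nat_assoc {W} {X Y : Word s .a} (f : Hom E X Y) (k : Hom E W _) :
    pL Y ⊙ Hom.map .L (Hom.map .U f) ⊙ k = f ⊙ pL X ⊙ k := by
  rw [comp_of_eq (pL_nat f), assoc]

@[simp] theorem gL_nat_assoc {W} {X Y : Word s .b} (f : Hom E X Y) (k : Hom E W _) :
    Hom.map .U (Hom.map .L f) ⊙ gL X ⊙ k = gL Y ⊙ f ⊙ k := by
  rw [comp_of_eq (gL_nat f), assoc]

@[simp] theorem pR_nat_assoc {W} {X Y : Word s .b} (f : Hom E X Y) (k : Hom E W _) :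
    pR Y ⊙ Hom.map .U (Hom.map .R f) ⊙ k = f ⊙ pR X ⊙ k := by
  rw [comp_of_eq (pR_nat f), assoc]

@[simp] theorem gR_nat_assoc {W} {X Y : Word s .a} (f : Hom E X Y) (k : Hom E W _) :
    Hom.map .R (Hom.map .U f) ⊙ gR X ⊙ k = gR Y ⊙ f ⊙ k := by
  rw [comp_of_eq (gR_nat f), assoc]

@[simp] theorem tri_L_assoc {W} (X : Word s .b) (k : Hom E W _) :
    pL (.cons .L X) ⊙ Hom.map .L (gL X) ⊙ k = k := by
  rw [comp_of_eq (tri_L X), id_comp]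

@[simp] theorem tri_UL_assoc {W} (X : Word s .a) (k : Hom E W _) :
    Hom.map .U (pL X) ⊙ gL (.cons .U X) ⊙ k = k := by
  rw [comp_of_eq (tri_UL X), id_comp]

@[simp] theorem tri_UR_assoc {W} (X : Word s .a) (k : Hom E W _) :
    pR (.cons .U X) ⊙ Hom.map .U (gR X) ⊙ k = k := by
  rw [comp_of_eq (tri_UR X), id_comp]

@[simp] theorem tri_R_assoc {W} (X : Word s .b) (k : Hom E W _) :
    Hom.map .R (pR X) ⊙ gR (.cons .R X) ⊙ k = k := by
  rw [comp_of_eq (tri_R X), id_comp]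

end Reassoc

/-! ### Normal forms -/

/-- Arrows built with counits only. Reading the letters of the source from the left, each letter is
either kept (`map`) or matched by a counit with a later letter; `capL` and `capU` code the latter,
transposing the rest of the arrow so that the partner is a kept letter. -/
inductive Cap : ∀ {t : Side}, Word s t → Word s t → Type
  | nil : Cap .nil .nil
  | map {t u : Side} (F : Fn t u) {X Z : Word s t} (e : Cap X Z) : Cap (.cons F X) (.cons F Z)
  | capL {X : Word s .b} {Z : Word s .a} (e : Cap X (.cons .U Z)) : Cap (.cons .L X) Z
  | capU {X : Word s .a} {Z : Word s .b} (e : Cap X (.cons .R Z)) : Cap (.cons .U X) Z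

/-- Arrows built with units only: the dual of `Cap`. -/
inductive Cup : ∀ {t : Side}, Word s t → Word s t → Type
  | nil : Cup .nil .nil
  | map {t u : Side} (F : Fn t u) {Z Y : Word s t} (c : Cup Z Y) : Cup (.cons F Z) (.cons F Y)
  | cupU {Z : Word s .b} {Y : Word s .a} (c : Cup (.cons .L Z) Y) : Cup Z (.cons .U Y)
  | cupR {Z : Word s .a} {Y : Word s .b} (c : Cup (.cons .U Z) Y) : Cup Z (.cons .R Y)

/-- The canonical arrow term coded by an element of `Cap`. -/
def Cap.toArr : ∀ {t : Side} {X Z : Word s t}, Cap X Z → Arr X Z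
  | _, _, _, .nil => .id _
  | _, _, _, .map F e => .map F e.toArr
  | _, _, _, .capL e => .comp (.phiL _) (.map .L e.toArr)
  | _, _, _, .capU e => .comp (.phiR _) (.map .U e.toArr)

/-- The canonical arrow term coded by an element of `Cup`. -/
def Cup.toArr : ∀ {t : Side} {Z Y : Word s t}, Cup Z Y → Arr Z Y
  | _, _, _, .nil => .id _
  | _, _, _, .map F c => .map F c.toArr
  | _, _, _, .cupU c => .comp (.map .U c.toArr) (.gammaL _)
  | _, _, _, .cupR c => .comp (.map .R c.toArr) (.gammaR _)

/-- The canonical arrow coded by an element of `Cap`. -/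
def Cap.hom (E : ArrEqSet) {X Z : Word s t} (e : Cap X Z) : Hom E X Z := mk E e.toArr

/-- The canonical arrow coded by an element of `Cup`. -/
def Cup.hom (E : ArrEqSet) {Z Y : Word s t} (c : Cup Z Y) : Hom E Z Y := mk E c.toArr

@[simp] theorem Cap.hom_nil : (Cap.nil : Cap (.nil : Word s s) _).hom E = Hom.id E _ := rfl
@[simp] theorem Cap.hom_map (F : Fn t u) {X Z : Word s t} (e : Cap X Z) :
    (Cap.map F e).hom E = Hom.map F (e.hom E) := rfl
@[simp] theorem Cap.hom_capL {X : Word s .b} {Z : Word s .a} (e : Cap X (.cons .U Z)) :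
    (Cap.capL e).hom E = pL _ ⊙ Hom.map .L (e.hom E) := rfl
@[simp] theorem Cap.hom_capU {X : Word s .a} {Z : Word s .b} (e : Cap X (.cons .R Z)) :
    (Cap.capU e).hom E = pR _ ⊙ Hom.map .U (e.hom E) := rfl
@[simp] theorem Cup.hom_nil : (Cup.nil : Cup (.nil : Word s s) _).hom E = Hom.id E _ := rfl
@[simp] theorem Cup.hom_map (F : Fn t u) {Z Y : Word s t} (c : Cup Z Y) :
    (Cup.map F c).hom E = Hom.map F (c.hom E) := rfl
@[simp] theorem Cup.hom_cupU {Z : Word s .b} {Y : Word s .a} (c : Cup (.cons .L Z) Y) :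
    (Cup.cupU c).hom E = Hom.map .U (c.hom E) ⊙ gL _ := rfl
@[simp] theorem Cup.hom_cupR {Z : Word s .a} {Y : Word s .b} (c : Cup (.cons .U Z) Y) :
    (Cup.cupR c).hom E = Hom.map .R (c.hom E) ⊙ gR _ := rfl

/-- The code of the identity arrow: every letter is kept. -/
def Cap.id : ∀ {t : Side} (X : Word s t), Cap X X
  | _, .nil => .nil
  | _, .cons F X => .map F (Cap.id X)

/-- The code of the identity arrow: every letter is kept. -/
def Cup.id : ∀ {t : Side} (X : Word s t), Cup X X
  | _, .nil => .nil
  | _, .cons F X => .map F (Cup.id X)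

@[simp] theorem Cap.hom_id (X : Word s t) : (Cap.id X).hom E = Hom.id E X := by
  induction X with
  | nil => rfl
  | cons F X ih => simp [Cap.id, ih]

@[simp] theorem Cup.hom_id (X : Word s t) : (Cup.id X).hom E = Hom.id E X := by
  induction X with
  | nil => rfl
  | cons F X ih => simp [Cup.id, ih]

theorem Cap.exists_comp {X Y : Word s t} (e : Cap X Y) :
    ∀ {Z : Word s t} (e' : Cap Y Z), ∃ e'' : Cap X Z, ∀ E, e''.hom E = e'.hom E ⊙ e.hom E := by
  induction e with
  | nil => intro Z e'; exact ⟨e', fun E => by simp⟩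
  | map F e ih =>
    intro Z e'
    cases e' with
    | map _ e' =>
      obtain ⟨e'', h⟩ := ih e'
      exact ⟨.map F e'', fun E => by simp [h]⟩
    | capL e' =>
      obtain ⟨e'', h⟩ := ih e'
      exact ⟨.capL e'', fun E => by simp [h]⟩
    | capU e' =>
      obtain ⟨e'', h⟩ := ih e'
      exact ⟨.capU e'', fun E => by simp [h]⟩
  | capL e ih =>
    intro Z e'
    obtain ⟨e'', h⟩ := ih (.map .U e')
    exact ⟨.capL e'', fun E => by simp [h]⟩
  | capU e ih =>
    intro Z e'
    obtain ⟨e'', h⟩ := ih (.map .R e')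
    exact ⟨.capU e'', fun E => by simp [h]⟩

theorem Cup.exists_comp {Y Z : Word s t} (c : Cup Y Z) :
    ∀ {X : Word s t} (c' : Cup X Y), ∃ c'' : Cup X Z, ∀ E, c''.hom E = c.hom E ⊙ c'.hom E := by
  induction c with
  | nil => intro X c'; exact ⟨c', fun E => by simp⟩
  | map F c ih =>
    intro X c'
    cases c' with
    | map _ c' =>
      obtain ⟨c'', h⟩ := ih c'
      exact ⟨.map F c'', fun E => by simp [h]⟩
    | cupU c' =>
      obtain ⟨c'', h⟩ := ih c'
      exact ⟨.cupU c'', fun E => by simp [h]⟩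
    | cupR c' =>
      obtain ⟨c'', h⟩ := ih c'
      exact ⟨.cupR c'', fun E => by simp [h]⟩
  | cupU c ih =>
    intro X c'
    obtain ⟨c'', h⟩ := ih (.map .L c')
    exact ⟨.cupU c'', fun E => by simp [h]⟩
  | cupR c ih =>
    intro X c'
    obtain ⟨c'', h⟩ := ih (.map .U c')
    exact ⟨.cupR c'', fun E => by simp [h]⟩

/-- Normal forms: counits first, units last. They code the planar matchings of the letters of the
source and of the target; `fst` is the word of the letters matched across. -/
abbrev NF (X Y : Word s t) : Type := Σ Z : Word s t, Cap X Z × Cup Z Y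

/-- The canonical arrow with a given normal form. -/
def NF.hom (E : ArrEqSet) {X Y : Word s t} (n : NF X Y) : Hom E X Y :=
  n.2.2.hom E ⊙ n.2.1.hom E

/-- Counits can be moved before units. A counit and a unit that meet share exactly one letter,
and cancel by a triangular equation. -/
theorem exists_interchange {Z Y : Word s t} (c : Cup Z Y) :
    ∀ {W : Word s t} (e : Cap Y W), ∃ n : NF Z W, ∀ E, n.hom E = e.hom E ⊙ c.hom E := by
  induction c with
  | nil => intro W e; exact ⟨⟨W, e, Cup.id W⟩, fun E => by simp [NF.hom]⟩
  | map F c ih =>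
    intro W e
    cases e with
    | map _ e =>
      obtain ⟨⟨V, e₂, c₂⟩, h⟩ := ih e
      exact ⟨⟨_, .map F e₂, .map F c₂⟩, fun E => by simp [NF.hom, ← map_comp, ← h]⟩
    | capL e =>
      obtain ⟨⟨V, e₂, c₂⟩, h⟩ := ih e
      cases c₂ with
      | map _ c₃ =>
        exact ⟨⟨_, .capL e₂, c₃⟩, fun E => by
          simp only [Cap.hom_capL, Cup.hom_map, assoc, ← map_comp, ← h]; simp [NF.hom]⟩
      | cupU c₃ =>
        exact ⟨⟨_, .map .L e₂, c₃⟩, fun E => by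
          simp only [Cap.hom_capL, Cup.hom_map, assoc, ← map_comp, ← h]; simp [NF.hom]⟩
    | capU e =>
      obtain ⟨⟨V, e₂, c₂⟩, h⟩ := ih e
      cases c₂ with
      | map _ c₃ =>
        exact ⟨⟨_, .capU e₂, c₃⟩, fun E => by
          simp only [Cap.hom_capU, Cup.hom_map, assoc, ← map_comp, ← h]; simp [NF.hom]⟩
      | cupR c₃ =>
        exact ⟨⟨_, .map .U e₂, c₃⟩, fun E => by
          simp only [Cap.hom_capU, Cup.hom_map, assoc, ← map_comp, ← h]; simp [NF.hom]⟩
  | cupU c ih =>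
    intro W e
    cases e with
    | map _ e =>
      obtain ⟨⟨V, e₂, c₂⟩, h⟩ := ih e
      cases e₂ with
      | map _ e₃ =>
        exact ⟨⟨_, e₃, .cupU c₂⟩, fun E => by
          simp only [Cap.hom_map, Cup.hom_cupU, ← assoc, ← map_comp, ← h]; simp [NF.hom]⟩
      | capL e₃ =>
        exact ⟨⟨_, e₃, .map .U c₂⟩, fun E => by
          simp only [Cap.hom_map, Cup.hom_cupU, ← assoc, ← map_comp, ← h]; simp [NF.hom]⟩
    | capU e =>
      obtain ⟨⟨V, e₂, c₂⟩, h⟩ := ih e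
      have key : ∀ E, (Cap.capU e).hom E ⊙ (Cup.cupU c).hom E =
          pR _ ⊙ Hom.map .U (c₂.hom E) ⊙ Hom.map .U (e₂.hom E) ⊙ gL _ := fun E => by
        have := h E
        simp only [NF.hom] at this
        simp only [Cap.hom_capU, Cup.hom_cupU, assoc]
        rw [comp_of_eq (map_comp _ _ _).symm, comp_of_eq (map_comp _ _ _).symm, this]
      cases e₂ with
      | map _ e₃ =>
        cases c₂ with
        | cupR c₃ =>
          obtain ⟨c₄, h₄⟩ := c₃.exists_comp (.cupU (Cup.id _))
          exact ⟨⟨_, e₃, c₄⟩, fun E => by rw [key]; simp [NF.hom, h₄]⟩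
      | capL e₃ =>
        cases c₂ with
        | map _ c₃ =>
          obtain ⟨e₄, h₄⟩ := e₃.exists_comp (.capU (Cap.id _))
          exact ⟨⟨_, e₄, c₃⟩, fun E => by rw [key]; simp [NF.hom, h₄]⟩
        | cupR c₃ =>
          exact ⟨⟨_, e₃, c₃⟩, fun E => by rw [key]; simp [NF.hom]⟩
  | cupR c ih =>
    intro W e
    cases e with
    | map _ e =>
      obtain ⟨⟨V, e₂, c₂⟩, h⟩ := ih e
      cases e₂ with
      | map _ e₃ =>
        exact ⟨⟨_, e₃, .cupR c₂⟩, fun E => by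
          simp only [Cap.hom_map, Cup.hom_cupR, ← assoc, ← map_comp, ← h]; simp [NF.hom]⟩
      | capU e₃ =>
        exact ⟨⟨_, e₃, .map .R c₂⟩, fun E => by
          simp only [Cap.hom_map, Cup.hom_cupR, ← assoc, ← map_comp, ← h]; simp [NF.hom]⟩

/-- Every canonical arrow term has a normal form, independent of the equations assumed. -/
theorem exists_nf {X Y : Word s t} (f : Arr X Y) : ∃ n : NF X Y, ∀ E, n.hom E = mk E f := by
  induction f with
  | id X => exact ⟨⟨X, Cap.id X, Cup.id X⟩, fun E => by simp [NF.hom, mk_id]⟩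
  | comp g f ihg ihf =>
    obtain ⟨⟨_, e, c⟩, h⟩ := ihf
    obtain ⟨⟨_, e', c'⟩, h'⟩ := ihg
    obtain ⟨⟨_, e₂, c₂⟩, h₂⟩ := exists_interchange c e'
    obtain ⟨e₃, h₃⟩ := e.exists_comp e₂
    obtain ⟨c₃, h₄⟩ := c'.exists_comp c₂
    refine ⟨⟨_, e₃, c₃⟩, fun E => ?_⟩
    have h₂ := h₂ E
    simp only [NF.hom] at h₂
    rw [mk_comp, ← h, ← h']
    simp only [NF.hom, h₃, h₄, assoc, comp_of_eq h₂]
  | map F f ih =>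
    obtain ⟨⟨_, e, c⟩, h⟩ := ih
    exact ⟨⟨_, .map F e, .map F c⟩, fun E => by rw [mk_map, ← h]; simp [NF.hom]⟩
  | phiL X => exact ⟨⟨X, .capL (Cap.id _), Cup.id X⟩, fun E => by simp [NF.hom, mk_phiL]⟩
  | gammaL X => exact ⟨⟨X, Cap.id X, .cupU (Cup.id _)⟩, fun E => by simp [NF.hom, mk_gammaL]⟩
  | phiR X => exact ⟨⟨X, .capU (Cap.id _), Cup.id X⟩, fun E => by simp [NF.hom, mk_phiR]⟩
  | gammaR X => exact ⟨⟨X, Cap.id X, .cupR (Cup.id _)⟩, fun E => by simp [NF.hom, mk_gammaR]⟩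

theorem Hom.exists_nf {X Y : Word s t} (f : Hom E X Y) : ∃ n : NF X Y, n.hom E = f := by
  obtain ⟨f, rfl⟩ := exists_mk f
  obtain ⟨n, h⟩ := Trijunction.exists_nf f
  exact ⟨n, h E⟩


/-! ### Sections and retractions -/

/-- Composition with `U` on the left of the words that end in the category `a`. -/
def Word.up : ∀ {t : Side}, Word s t → Word s .b
  | .a, X => .cons .U X
  | .b, X => X

/-- Application of `U` to the arrows between words that end in the category `a`. -/
def Hom.up : ∀ {t : Side} {X Y : Word s t}, Hom E X Y → Hom E X.up Y.up
  | .a, _, _, f => Hom.map .U f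
  | .b, _, _, f => f

@[simp] theorem Word.up_a (X : Word s .a) : X.up = .cons .U X := rfl
@[simp] theorem Word.up_b (X : Word s .b) : X.up = X := rfl
@[simp] theorem Hom.up_a {X Y : Word s .a} (f : Hom E X Y) : f.up = Hom.map .U f := rfl
@[simp] theorem Hom.up_b {X Y : Word s .b} (f : Hom E X Y) : f.up = f := rfl

theorem map_comp_of_eq (F : Fn t u) {X Y Z : Word s t} {g : Hom E Y Z} {f : Hom E X Y}
    {h : Hom E X Z} (e : g ⊙ f = h) : Hom.map F g ⊙ Hom.map F f = Hom.map F h := by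
  rw [← map_comp, e]

theorem map_comp_of_eq_assoc (F : Fn t u) {W : Word s u} {X Y Z : Word s t} {g : Hom E Y Z}
    {f : Hom E X Y} {h : Hom E X Z} (e : g ⊙ f = h) (k : Hom E W (.cons F X)) :
    Hom.map F g ⊙ Hom.map F f ⊙ k = Hom.map F h ⊙ k :=
  comp_of_eq (map_comp_of_eq F e) k

/-- Every arrow built with counits has a section when `U` is on both ends of its words. -/
theorem Cap.exists_section (E : ArrEqSet) {X Z : Word .a t} (e : Cap X Z) :
    ∃ g : Hom E Z.up X.up, (e.hom E).up ⊙ g = Hom.id E _ := by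
  induction e with
  | nil => exact ⟨Hom.id E _, (comp_id _).trans (map_id _ _)⟩
  | map F e ih =>
    obtain ⟨g, h⟩ := ih
    cases F <;> simp only [Hom.up, Word.up] at g h ⊢
    · exact ⟨g, h⟩
    · exact ⟨Hom.map .U (Hom.map .L g), by simp [← map_comp, h]⟩
    · exact ⟨Hom.map .U (Hom.map .R g), by simp [← map_comp, h]⟩
  | capL e ih =>
    obtain ⟨g, h⟩ := ih
    simp only [Hom.up, Word.up] at g h ⊢
    exact ⟨Hom.map .U (Hom.map .L g) ⊙ gL _, by simp [h]⟩
  | @capU X Z e ih =>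
    obtain ⟨g, h⟩ := ih
    cases Z with
    | cons F Z =>
      cases F
      simp only [Hom.up, Word.up] at g h ⊢
      exact ⟨g ⊙ Hom.map .U (gR _), by simp [comp_of_eq h]⟩

/-- Every arrow built with units has a retraction when `U` is on both ends of its words. -/
theorem Cup.exists_retraction (E : ArrEqSet) {Z Y : Word .a t} (c : Cup Z Y) :
    ∃ g : Hom E Y.up Z.up, g ⊙ (c.hom E).up = Hom.id E _ := by
  induction c with
  | nil => exact ⟨Hom.id E _, (id_comp _).trans (map_id _ _)⟩
  | map F c ih =>
    obtain ⟨g, h⟩ := ih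
    cases F <;> simp only [Hom.up, Word.up] at g h ⊢
    · exact ⟨g, h⟩
    · exact ⟨Hom.map .U (Hom.map .L g), by simp [← map_comp, h]⟩
    · exact ⟨Hom.map .U (Hom.map .R g), by simp [← map_comp, h]⟩
  | @cupU Z Y c ih =>
    obtain ⟨g, h⟩ := ih
    cases Z with
    | cons F Z =>
      cases F
      simp only [Hom.up, Word.up] at g h ⊢
      exact ⟨Hom.map .U (pL _) ⊙ g, by simp [comp_of_eq h]⟩
  | cupR c ih =>
    obtain ⟨g, h⟩ := ih
    simp only [Hom.up, Word.up] at g h ⊢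
    exact ⟨pR _ ⊙ Hom.map .U (Hom.map .R g), by
      simp only [Cup.hom_cupR, map_comp, assoc, map_comp_of_eq_assoc .U (map_comp_of_eq .R h)]
      simp⟩

/-- The functor `U` is a retract of every canonical functor of its type. -/
theorem exists_retract (E : ArrEqSet) (Z : Word .a t) :
    ∃ (i : Hom E (.cons .U .nil) Z.up) (r : Hom E Z.up (.cons .U .nil)), r ⊙ i = Hom.id E _ := by
  induction Z with
  | nil => exact ⟨Hom.id E _, Hom.id E _, comp_id _⟩
  | cons F Z ih =>
    obtain ⟨i, r, h⟩ := ih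
    cases F <;> simp only [Word.up] at i r h ⊢
    · exact ⟨i, r, h⟩
    · exact ⟨Hom.map .U (Hom.map .L i) ⊙ gL _, Hom.map .U (pL _) ⊙ Hom.map .U (Hom.map .L r), by
        simp [h]⟩
    · exact ⟨Hom.map .U (Hom.map .R i) ⊙ Hom.map .U (gR _), pR _ ⊙ Hom.map .U (Hom.map .R r), by
        simp only [assoc, map_comp_of_eq_assoc .U (map_comp_of_eq .R h)]
        simp⟩

/-! ### Collapsing equations -/

/-- The split epimorphism `U φL` is invertible. -/
def InvL (E : ArrEqSet) (Z : Word s .a) : Prop :=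
  Hom.id E (.cons .U (.cons .L (.cons .U Z))) = gL _ ⊙ Hom.map .U (pL Z)

/-- The split epimorphism `φR U` is invertible. -/
def InvR (E : ArrEqSet) (Z : Word s .a) : Prop :=
  Hom.id E (.cons .U (.cons .R (.cons .U Z))) = Hom.map .U (gR Z) ⊙ pR _

/-- One of the two collapsing equations holds. -/
def Collapse (E : ArrEqSet) : Prop :=
  InvL E (.nil : Word .a .a) ∨ InvR E (.nil : Word .a .a)

/-- Since `U` is a retract of `U Z`, the arrow `U φL` at the empty word is a retract of `U φL` at
`Z`, hence invertible when the latter is. -/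
theorem InvL.collapse {Z : Word .a .a} (h : InvL E Z) : Collapse E := by
  left
  obtain ⟨i, r, hr⟩ := exists_retract E Z
  simp only [Word.up] at i r hr
  have h₁ : Hom.id E (.cons .U (.cons .L (.cons .U .nil))) =
      gL _ ⊙ r ⊙ Hom.map .U (pL Z) ⊙ Hom.map .U (Hom.map .L i) := by
    have h₂ : Hom.map .U (Hom.map .L r) ⊙ Hom.id E _ ⊙ Hom.map .U (Hom.map .L i) =
      Hom.id E _ := by rw [id_comp, ← map_comp, ← map_comp, hr, map_id, map_id]
    rw [← h₂, h]
    simp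
  have h₂ := congrArg (fun k => Hom.map .U (pL _) ⊙ k) h₁
  simp only [comp_id, tri_UL_assoc] at h₂
  rw [← h₂] at h₁
  exact h₁

/-- Since `U` is a retract of `U Z`, the arrow `φR U` at the empty word is a retract of `φR U` at
`Z`, hence invertible when the latter is. -/
theorem InvR.collapse {Z : Word .a .a} (h : InvR E Z) : Collapse E := by
  right
  obtain ⟨i, r, hr⟩ := exists_retract E Z
  simp only [Word.up] at i r hr
  have h₁ : Hom.id E (.cons .U (.cons .R (.cons .U .nil))) =
      (Hom.map .U (Hom.map .R r) ⊙ Hom.map .U (gR Z) ⊙ i) ⊙ pR _ := by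
    have h₂ : Hom.map .U (Hom.map .R r) ⊙ Hom.id E _ ⊙ Hom.map .U (Hom.map .R i) =
      Hom.id E _ := by rw [id_comp, ← map_comp, ← map_comp, hr, map_id, map_id]
    rw [← h₂, h]
    simp
  have h₂ := congrArg (fun k => k ⊙ Hom.map .U (gR _)) h₁
  simp only [id_comp, assoc (_ ⊙ _), comp_id, tri_UR] at h₂
  rw [← h₂] at h₁
  exact h₁

/-- Number of letters. -/
def Word.len : ∀ {t : Side}, Word s t → ℕ
  | _, .nil => 0
  | _, .cons _ X => X.len + 1

/-- In the absence of collapse, an arrow built with counits that has a retraction matches no letters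
of its source. -/
theorem Cap.collapse_of_retraction {X Z : Word .a t} (e : Cap X Z) :
    ∀ k : Hom E Z.up X.up, k ⊙ (e.hom E).up = Hom.id E _ → Collapse E ∨ X.len ≤ Z.len := by
  induction e with
  | nil => intro _ _; right; exact le_rfl
  | @map t u F X Z e ih =>
    intro k hk
    simp only [Word.len, add_le_add_iff_right]
    cases F with
    | U => exact ih k hk
    | L =>
      cases X with | cons F X =>
      cases F
      refine ih (Hom.map .U (pL _) ⊙ k ⊙ gL _) ?_
      simp only [Hom.up_b, Hom.up_a, Word.up_b, Word.up_a, Cap.hom_map] at k hk ⊢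
      have := comp_of_eq hk (gL _)
      simp at this
      simp [this]
    | R =>
      obtain ⟨g, h⟩ := e.exists_section E
      cases X with | cons F X =>
      cases F
      refine ih g ?_
      simp only [Hom.up_b, Hom.up_a, Word.up_b, Word.up_a, Cap.hom_map] at g h k hk ⊢
      have h₁ : k = Hom.map .U (Hom.map .R g) := by
        have h₂ := comp_of_eq hk (Hom.map .U (Hom.map .R g))
        rw [map_comp_of_eq .U (map_comp_of_eq .R h)] at h₂
        simpa using h₂
      have h₃ := congrArg (fun f => pR _ ⊙ f ⊙ Hom.map .U (gR _)) hk
      simpa [h₁] using h₃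
  | @capL X Z e ih =>
    intro k hk
    left
    obtain ⟨g, h⟩ := e.exists_section E
    simp only [Hom.up_b, Hom.up_a, Word.up_b, Word.up_a, Cap.hom_capL] at g h k hk
    refine InvL.collapse (Z := Z) ?_
    have h₀ := map_comp_of_eq .U (map_comp_of_eq .L h)
    simp only [map_comp] at hk
    have h₁ : Hom.map .U (Hom.map .L g) = k ⊙ Hom.map .U (pL _) := by
      have h₂ := comp_of_eq hk (Hom.map .U (Hom.map .L g))
      simpa [h₀] using h₂.symm
    have h₂ : k = Hom.map .U (Hom.map .L g) ⊙ gL _ := by simp [h₁]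
    rw [h₂] at h₁
    have h₃ := congrArg (fun f => Hom.map .U (Hom.map .L (e.hom E)) ⊙ f) h₁
    simp only [h₀, assoc, comp_of_eq h₀] at h₃
    simpa [InvL] using h₃
  | @capU X Z e ih =>
    intro k hk
    left
    obtain ⟨g, h⟩ := e.exists_section E
    cases Z with | cons F Z =>
    cases F
    simp only [Hom.up_b, Hom.up_a, Word.up_b, Word.up_a, Cap.hom_capU] at g h k hk
    refine InvR.collapse (Z := Z) ?_
    have h₁ : g = k ⊙ pR _ := by
      have h₂ := comp_of_eq hk g
      simpa [h] using h₂.symm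
    have h₂ : k = g ⊙ Hom.map .U (gR _) := by simp [h₁]
    rw [h₂] at h₁
    have h₃ := congrArg (fun f => Hom.map .U (e.hom E) ⊙ f) h₁
    simp only [h, assoc, comp_of_eq h] at h₃
    simpa [InvR] using h₃

/-! ### Distinctness of normal forms in the absence of collapse -/

/-- Transposing twice along `L ⊣ U` gives back the arrow. -/
@[simp] theorem map_transpose_L {X : Word s .b} {Z : Word s .a} (f : Hom E X (.cons .U Z)) :
    Hom.map .U (pL _ ⊙ Hom.map .L f) ⊙ gL X = f := by
  simp

/-- Transposing twice along `U ⊣ R` gives back the arrow. -/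
theorem map_transpose_R {X : Word s .a} {Z : Word s .b} (f : Hom E X (.cons .R Z)) :
    Hom.map .R (pR _ ⊙ Hom.map .U f) ⊙ gR X = f := by
  simp

/-- Transposing twice along `L ⊣ U` gives back the arrow. -/
theorem transpose_L_map {X : Word s .b} {Z : Word s .a} (f : Hom E (.cons .L X) Z) :
    pL _ ⊙ Hom.map .L (Hom.map .U f ⊙ gL X) = f := by
  simp

/-- Transposing twice along `U ⊣ R` gives back the arrow. -/
theorem transpose_R_map {X : Word s .a} {Z : Word s .b} (f : Hom E (.cons .U X) Z) :
    pR _ ⊙ Hom.map .U (Hom.map .R f ⊙ gR X) = f := by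
  simp

/-- The unit `γL U`, a section of `U φL`, is inverse to it as soon as a composite `γL U ⊙ f` has a
section. -/
theorem invL_of_section {X : Word s .b} {Z : Word s .a} {f : Hom E X (.cons .U Z)}
    {g : Hom E (.cons .U (.cons .L (.cons .U Z))) X} (h : (gL _ ⊙ f) ⊙ g = Hom.id E _) :
    InvL E Z := by
  have h₁ := congrArg (fun k => Hom.map .U (pL _) ⊙ k) h
  simp only [assoc, tri_UL_assoc, comp_id] at h₁
  rw [InvL, ← h₁, ← assoc, h]

/-- The analogue of `invL_of_section` for the section `U γR` of `φR U`. -/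
theorem invR_of_section {X : Word s .b} {Z : Word s .a} {f : Hom E X (.cons .U Z)}
    {g : Hom E (.cons .U (.cons .R (.cons .U Z))) X}
    (h : (Hom.map .U (gR _) ⊙ f) ⊙ g = Hom.id E _) : InvR E Z := by
  have h₁ := congrArg (fun k => pR _ ⊙ k) h
  simp only [assoc, tri_UR_assoc, comp_id] at h₁
  rw [InvR, ← h₁, ← assoc, h]

/-- The arrow `U φL`, which has a section, is invertible as soon as a composite `f ⊙ U φL` has a
retraction. -/
theorem invL_of_retraction {X : Word s .b} {Z : Word s .a} {f : Hom E (.cons .U Z) X}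
    {g : Hom E X (.cons .U (.cons .L (.cons .U Z)))}
    (h : g ⊙ f ⊙ Hom.map .U (pL _) = Hom.id E _) : InvL E Z := by
  have h₁ := congrArg (fun k => k ⊙ gL _) h
  simp only [assoc, tri_UL, comp_id, id_comp] at h₁
  rw [InvL, ← h₁, assoc, h]

/-- The analogue of `invL_of_retraction` for `φR U`. -/
theorem invR_of_retraction {X : Word s .b} {Z : Word s .a} {f : Hom E (.cons .U Z) X}
    {g : Hom E X (.cons .U (.cons .R (.cons .U Z)))}
    (h : g ⊙ f ⊙ pR _ = Hom.id E _) : InvR E Z := by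
  have h₁ := congrArg (fun k => k ⊙ Hom.map .U (gR _)) h
  simp only [assoc, tri_UR, comp_id, id_comp] at h₁
  rw [InvR, ← h₁, assoc, h]

/-- Collapse follows from the equality of two arrows built with counits, one of which keeps the
first letter `L` of the source while the other matches it: transposed, the equality makes a unit
the left factor of an arrow that has a section. -/
theorem Cap.collapse_of_map_L {X : Word .a .b} {Z : Word .a .b} (e : Cap X Z)
    (e' : Cap X (.cons .U (.cons .L Z)))
    (h : Hom.map .L (e.hom E) = pL _ ⊙ Hom.map .L (e'.hom E)) : Collapse E := by
  cases Z with | cons F Z =>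
  cases F
  have h₁ := congrArg (fun f => Hom.map .U f ⊙ gL _) h
  simp only [gL_nat, map_transpose_L] at h₁
  obtain ⟨g, hg⟩ := e'.exists_section E
  rw [← h₁] at hg
  exact (invL_of_section hg).collapse

/-- The analogue of `Cap.collapse_of_map_L` for the first letter `U`. -/
theorem Cap.collapse_of_map_U {X : Word .a .a} {Z : Word .a .a} (e : Cap X Z)
    (e' : Cap X (.cons .R (.cons .U Z)))
    (h : Hom.map .U (e.hom E) = pR _ ⊙ Hom.map .U (e'.hom E)) : Collapse E := by
  have h₁ := congrArg (fun f => Hom.map .R f ⊙ gR _) h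
  simp only [gR_nat, map_transpose_R] at h₁
  obtain ⟨g, hg⟩ := e'.exists_section E
  rw [← h₁, Hom.up_a, map_comp] at hg
  exact (invR_of_section hg).collapse

/-- Collapse follows from the equality of two arrows built with units, one of which keeps the first
letter `U` of the target while the other matches it: transposed, the equality makes a counit the
right factor of an arrow that has a retraction. -/
theorem Cup.collapse_of_map_U {Z : Word .a .a} {Y : Word .a .a} (c : Cup Z Y)
    (c' : Cup (.cons .L (.cons .U Z)) Y)
    (h : Hom.map .U (c.hom E) = Hom.map .U (c'.hom E) ⊙ gL _) : Collapse E := by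
  have h₁ := congrArg (fun f => pL _ ⊙ Hom.map .L f) h
  simp only [pL_nat, transpose_L_map] at h₁
  obtain ⟨g, hg⟩ := c'.exists_retraction E
  rw [← h₁, Hom.up_a, map_comp] at hg
  exact (invL_of_retraction hg).collapse

/-- The analogue of `Cup.collapse_of_map_U` for the first letter `R`. -/
theorem Cup.collapse_of_map_R {Z : Word .a .b} {Y : Word .a .b} (c : Cup Z Y)
    (c' : Cup (.cons .U (.cons .R Z)) Y)
    (h : Hom.map .R (c.hom E) = Hom.map .R (c'.hom E) ⊙ gR _) : Collapse E := by
  cases Z with | cons F Z =>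
  cases F
  have h₁ := congrArg (fun f => pR _ ⊙ Hom.map .U f) h
  simp only [pR_nat, transpose_R_map] at h₁
  obtain ⟨g, hg⟩ := c'.exists_retraction E
  rw [← h₁] at hg
  exact (invR_of_retraction hg).collapse

/-- The functor `U` is faithful on canonical arrows. -/
theorem map_U_injective {X Y : Word s .a} {f g : Hom E X Y}
    (h : Hom.map .U f = Hom.map .U g) : f = g := by
  -- If the source begins with `L` or the target begins with `R`, then `f` is a transpose of an
  -- arrow determined by `U f`. Otherwise both words are empty, as normal forms show.
  obtain ⟨⟨Z, e, c⟩, rfl⟩ := f.exists_nf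
  obtain ⟨⟨Z', e', c'⟩, rfl⟩ := g.exists_nf
  have hL : ∀ {X : Word s .b} {Y : Word s .a} {f g : Hom E (.cons .L X) Y},
      Hom.map .U f = Hom.map .U g → f = g := fun {X Y f g} h => by
    rw [← transpose_L_map f, h, transpose_L_map]
  have hR : ∀ {X : Word s .a} {Y : Word s .b} {f g : Hom E X (.cons .R Y)},
      Hom.map .U f = Hom.map .U g → f = g := fun {X Y f g} h => by
    rw [← map_transpose_R f, h, map_transpose_R]
  cases e with
  | nil =>
    cases c with
    | nil => cases e'; cases c'; rfl
    | cupR => exact hR h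
  | capL => exact hL h
  | map F e =>
    cases F with
    | L => exact hL h
    | R =>
      cases c with
      | map => exact hR h
      | cupR => exact hR h

/-- On words that begin in `a`, hence are empty or have `U` on the right, `L` and `R` are faithful
too. -/
theorem map_injective (F : Fn t u) {X Y : Word .a t} {f g : Hom E X Y}
    (h : Hom.map F f = Hom.map F g) : f = g := by
  cases F with
  | U => exact map_U_injective h
  | L =>
    cases Y with | cons F Y =>
    cases F
    have h₁ := congrArg (fun k => Hom.map .U (pL _) ⊙ Hom.map .U k ⊙ gL _) h
    simpa using h₁
  | R =>
    cases X with | cons F X =>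
    cases F
    have h₁ := congrArg (fun k => pR _ ⊙ Hom.map .U k ⊙ Hom.map .U (gR _)) h
    simpa using h₁

/-- In the absence of collapse, equal arrows built with counits have the same code. -/
theorem Cap.collapse_or_eq {X Z : Word .a t} (e : Cap X Z) :
    ∀ e' : Cap X Z, e.hom E = e'.hom E → Collapse E ∨ e = e' := by
  induction e with
  | nil => rintro ⟨⟩ _; exact .inr rfl
  | map F e ih =>
    intro e' h
    cases e' with
    | map _ e' => exact (ih e' (map_injective F h)).imp_right (congrArg _)
    | capL e' => exact .inl (e.collapse_of_map_L e' h)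
    | capU e' => exact .inl (e.collapse_of_map_U e' h)
  | capL e ih =>
    intro e' h
    cases e' with
    | map _ e' => exact .inl (e'.collapse_of_map_L e h.symm)
    | capL e' =>
      refine (ih e' ?_).imp_right (congrArg _)
      rw [← map_transpose_L (e.hom E), ← map_transpose_L (e'.hom E)]
      exact congrArg (fun f => Hom.map .U f ⊙ gL _) h
  | capU e ih =>
    intro e' h
    cases e' with
    | map _ e' => exact .inl (e'.collapse_of_map_U e h.symm)
    | capU e' =>
      refine (ih e' ?_).imp_right (congrArg _)
      rw [← map_transpose_R (e.hom E), ← map_transpose_R (e'.hom E)]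
      exact congrArg (fun f => Hom.map .R f ⊙ gR _) h

/-- In the absence of collapse, equal arrows built with units have the same code. -/
theorem Cup.collapse_or_eq {Z Y : Word .a t} (c : Cup Z Y) :
    ∀ c' : Cup Z Y, c.hom E = c'.hom E → Collapse E ∨ c = c' := by
  induction c with
  | nil => rintro ⟨⟩ _; exact .inr rfl
  | map F c ih =>
    intro c' h
    cases c' with
    | map _ c' => exact (ih c' (map_injective F h)).imp_right (congrArg _)
    | cupU c' => exact .inl (c.collapse_of_map_U c' h)
    | cupR c' => exact .inl (c.collapse_of_map_R c' h)
  | cupU c ih =>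
    intro c' h
    cases c' with
    | map _ c' => exact .inl (c'.collapse_of_map_U c h.symm)
    | cupU c' =>
      refine (ih c' ?_).imp_right (congrArg _)
      rw [← transpose_L_map (c.hom E), ← transpose_L_map (c'.hom E)]
      exact congrArg (fun f => pL _ ⊙ Hom.map .L f) h
  | cupR c ih =>
    intro c' h
    cases c' with
    | map _ c' => exact .inl (c'.collapse_of_map_R c h.symm)
    | cupR c' =>
      refine (ih c' ?_).imp_right (congrArg _)
      rw [← transpose_R_map (c.hom E), ← transpose_R_map (c'.hom E)]
      exact congrArg (fun f => pR _ ⊙ Hom.map .U f) h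

theorem Cap.len_le {X Z : Word s t} (e : Cap X Z) : Z.len ≤ X.len := by
  induction e <;> simp only [Word.len] at * <;> omega

theorem Cup.len_le {Z Y : Word s t} (c : Cup Z Y) : Z.len ≤ Y.len := by
  induction c <;> simp only [Word.len] at * <;> omega

theorem Cap.eq_id {X Z : Word s t} (e : Cap X Z) (h : X.len ≤ Z.len) :
    ∃ hX : X = Z, ∀ E, e.hom E = hX ▸ Hom.id E X := by
  induction e with
  | nil => exact ⟨rfl, fun _ => rfl⟩
  | map F e ih =>
    obtain ⟨rfl, h⟩ := ih (by simpa [Word.len] using h)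
    exact ⟨rfl, fun E => by simp [h]⟩
  | capL e ih => have := e.len_le; simp only [Word.len] at *; omega
  | capU e ih => have := e.len_le; simp only [Word.len] at *; omega

theorem Cup.eq_id {Z Y : Word s t} (c : Cup Z Y) (h : Y.len ≤ Z.len) :
    ∃ hZ : Z = Y, ∀ E, c.hom E = hZ ▸ Hom.id E Z := by
  induction c with
  | nil => exact ⟨rfl, fun _ => rfl⟩
  | map F c ih =>
    obtain ⟨rfl, h⟩ := ih (by simpa [Word.len] using h)
    exact ⟨rfl, fun E => by simp [h]⟩
  | cupU c ih => have := c.len_le; simp only [Word.len] at *; omega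
  | cupR c ih => have := c.len_le; simp only [Word.len] at *; omega

/-- In the absence of collapse, an arrow with a retraction is built with units only. -/
theorem exists_cup_of_retraction {Z Z' : Word .a .b} {b : Hom E Z Z'} {a : Hom E Z' Z}
    (h : a ⊙ b = Hom.id E _) : Collapse E ∨ ∃ c : Cup Z Z', c.hom E = b := by
  obtain ⟨⟨W, e, c⟩, rfl⟩ := b.exists_nf
  refine (e.collapse_of_retraction (a ⊙ c.hom E) (by simpa [NF.hom] using h)).imp_right fun hl => ?_
  obtain ⟨rfl, he⟩ := e.eq_id hl
  exact ⟨c, by simp [NF.hom, he]⟩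

/-- In the absence of collapse, equal arrows have the same normal form. -/
theorem NF.collapse_or_eq {X Y : Word .a .b} (n n' : NF X Y) (h : n.hom E = n'.hom E) :
    Collapse E ∨ n = n' := by
  obtain ⟨Z, e, c⟩ := n
  obtain ⟨Z', e', c'⟩ := n'
  obtain ⟨i, hi⟩ : ∃ i : Hom E Z X, e.hom E ⊙ i = Hom.id E Z := e.exists_section E
  obtain ⟨i', hi'⟩ : ∃ i : Hom E Z' X, e'.hom E ⊙ i = Hom.id E Z' := e'.exists_section E
  obtain ⟨r, hr⟩ : ∃ r : Hom E Y Z, r ⊙ c.hom E = Hom.id E Z := c.exists_retraction E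
  obtain ⟨r', hr'⟩ : ∃ r : Hom E Y Z', r ⊙ c'.hom E = Hom.id E Z' := c'.exists_retraction E
  simp only [NF.hom] at h
  -- The middle words of the two normal forms are isomorphic.
  have he : e.hom E = (r ⊙ c'.hom E) ⊙ e'.hom E := by
    rw [assoc, ← h, comp_of_eq hr, id_comp]
  have he' : e'.hom E = (r' ⊙ c.hom E) ⊙ e.hom E := by
    rw [assoc, h, comp_of_eq hr', id_comp]
  have hab : (r ⊙ c'.hom E) ⊙ (r' ⊙ c.hom E) = Hom.id E _ := by
    conv_rhs => rw [← hi, he, he']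
    simp [hi]
  have hba : (r' ⊙ c.hom E) ⊙ (r ⊙ c'.hom E) = Hom.id E _ := by
    conv_rhs => rw [← hi', he', he]
    simp [hi']
  obtain hC | ⟨b, hb⟩ := exists_cup_of_retraction hab
  · exact .inl hC
  obtain hC | ⟨a, ha⟩ := exists_cup_of_retraction hba
  · exact .inl hC
  obtain ⟨rfl, hb'⟩ := b.eq_id a.len_le
  rw [← hb, hb', id_comp] at he'
  have hc : c.hom E = c'.hom E := by
    rw [← comp_id (c.hom E), ← hi, ← assoc, h, assoc, he', hi, comp_id]
  obtain hC | rfl := e.collapse_or_eq e' he'.symm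
  · exact .inl hC
  obtain hC | rfl := c.collapse_or_eq c' hc
  · exact .inl hC
  exact .inr rfl


/-! ### Collapse makes all parallel arrows equal -/

theorem invR_of_invL (h : ∀ Z : Word s .a, InvL E Z) (Z : Word s .a) : InvR E Z := by
  -- The two ways to contract `U L U R U` to `U` are equal; the claim is a transpose of this.
  have h₁ : pR (.cons .U Z) ⊙ Hom.map .U (pL _) =
      Hom.map .U (pL Z) ⊙ Hom.map .U (Hom.map .L (pR (E := E) (.cons .U Z))) := by
    rw [← comp_id (Hom.map .U (pL Z) ⊙ _), h (.cons .R (.cons .U Z))]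
    simp
  have h₂ := congrArg (fun k => Hom.map .U (Hom.map .R k ⊙ gR _) ⊙ gL _) h₁
  simpa [InvR] using h₂

theorem invL_of_invR (h : ∀ Z : Word s .a, InvR E Z) (Z : Word s .a) : InvL E Z := by
  -- The two ways to contract `U L U R U` to `U` are equal; the claim is a transpose of this.
  have h₁ : ∀ Z : Word s .a, pR (.cons .U Z) ⊙ Hom.map .U (pL _) =
      Hom.map .U (pL Z ⊙ Hom.map .L (pR (E := E) (.cons .U Z))) := fun Z => by
    have h₂ : Hom.map .U (Hom.map .L (Hom.map .U (gR Z) ⊙ pR (E := E) _)) = Hom.id E _ := by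
      rw [← h Z]; simp
    rw [← comp_id (_ ⊙ Hom.map .U (pL _)), ← h₂]
    simp [map_comp_of_eq_assoc .U (pL_nat _)]
  have h₂ := congrArg
    (fun k => k ⊙ Hom.map .U (Hom.map .L (Hom.map .U (Hom.map .R (gL _) ⊙ gR _))))
    (h₁ (.cons .L (.cons .U Z)))
  have h₃ : Hom.map .U ((pL (.cons .L (.cons .U Z)) ⊙ Hom.map .L (pR (E := E) _)) ⊙
      Hom.map .L (Hom.map .U (Hom.map .R (gL _) ⊙ gR _))) = Hom.id E _ := by
    rw [assoc, ← map_comp .L]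
    simp
  simp only [← map_comp .U] at h₂
  rw [InvL, ← h₂.trans h₃, assoc, map_comp_of_eq .U (pL_nat _)]
  simp

/-- The words to which all words ending in `b` reduce under the collapsing equations. -/
inductive Reduced : ∀ {s : Side}, Word s .b → Prop
  | nil : Reduced .nil
  | U : Reduced (.cons .U .nil)
  | cons (F : Fn .b .a) : Reduced (.cons .U (.cons F .nil))

/-- Between two of these words there is at most one normal form. -/
theorem Reduced.hom_subsingleton {X Y : Word s .b} (hX : Reduced X) (hY : Reduced Y)
    (f g : Hom E X Y) : f = g := by
  have key : ∀ n n' : NF X Y, n = n' := by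
    rintro ⟨Z, e, c⟩ ⟨Z', e', c'⟩
    cases hX <;> cases hY <;>
      repeat' first | rfl | cases ‹Cap _ _› | cases ‹Cup _ _›
  obtain ⟨n, rfl⟩ := f.exists_nf
  obtain ⟨n', rfl⟩ := g.exists_nf
  rw [key n n']

/-- Under the collapsing equations `U L U` and `U R U` are isomorphic to `U`, so that every word
ending in `b` is isomorphic to a reduced one. -/
theorem exists_iso_reduced (hL : ∀ Z : Word s .a, InvL E Z) (hR : ∀ Z : Word s .a, InvR E Z)
    (X : Word s t) : ∃ Y : Word s .b, Reduced Y ∧ ∃ (i : Hom E X.up Y) (j : Hom E Y X.up),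
      j ⊙ i = Hom.id E _ ∧ i ⊙ j = Hom.id E _ := by
  induction X with
  | nil =>
    cases s
    · exact ⟨_, .U, Hom.id E _, Hom.id E _, comp_id _, comp_id _⟩
    · exact ⟨_, .nil, Hom.id E _, Hom.id E _, comp_id _, comp_id _⟩
  | cons F X ih =>
    obtain ⟨Y, hY, i, j, hji, hij⟩ := ih
    cases F with
    | U => exact ⟨Y, hY, i, j, hji, hij⟩
    | L =>
      simp only [Word.up_b] at i j hji hij
      have h₁ : Hom.map .U (Hom.map .L j) ⊙ Hom.map .U (Hom.map .L i) = Hom.id E _ := by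
        rw [← map_comp, ← map_comp, hji, map_id, map_id]
      have h₂ : Hom.map .U (Hom.map .L i) ⊙ Hom.map .U (Hom.map .L j) = Hom.id E _ := by
        rw [← map_comp, ← map_comp, hij, map_id, map_id]
      have h₃ : Reduced (.cons .U (.cons .L Y)) ∨ ∃ Z, Y = .cons .U Z := by
        cases hY
        · exact .inl (.cons .L)
        · exact .inr ⟨_, rfl⟩
        · exact .inr ⟨_, rfl⟩
      obtain h₃ | ⟨Z, rfl⟩ := h₃
      · exact ⟨_, h₃, _, _, h₁, h₂⟩
      · have h₄ : (Hom.map .U (Hom.map .L j) ⊙ gL _) ⊙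
            (Hom.map .U (pL Z) ⊙ Hom.map .U (Hom.map .L i)) = Hom.id E _ := by
          rw [assoc, ← assoc (gL _), ← hL, id_comp, h₁]
        have h₅ : (Hom.map .U (pL Z) ⊙ Hom.map .U (Hom.map .L i)) ⊙
            (Hom.map .U (Hom.map .L j) ⊙ gL _) = Hom.id E _ := by
          rw [assoc, comp_of_eq h₂]; simp
        exact ⟨_, hY, _, _, h₄, h₅⟩
    | R =>
      simp only [Word.up_b] at i j hji hij
      have h₁ : Hom.map .U (Hom.map .R j) ⊙ Hom.map .U (Hom.map .R i) = Hom.id E _ := by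
        rw [← map_comp, ← map_comp, hji, map_id, map_id]
      have h₂ : Hom.map .U (Hom.map .R i) ⊙ Hom.map .U (Hom.map .R j) = Hom.id E _ := by
        rw [← map_comp, ← map_comp, hij, map_id, map_id]
      have h₃ : Reduced (.cons .U (.cons .R Y)) ∨ ∃ Z, Y = .cons .U Z := by
        cases hY
        · exact .inl (.cons .R)
        · exact .inr ⟨_, rfl⟩
        · exact .inr ⟨_, rfl⟩
      obtain h₃ | ⟨Z, rfl⟩ := h₃
      · exact ⟨_, h₃, _, _, h₁, h₂⟩
      · have h₄ : (Hom.map .U (Hom.map .R j) ⊙ Hom.map .U (gR Z)) ⊙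
            (pR _ ⊙ Hom.map .U (Hom.map .R i)) = Hom.id E _ := by
          rw [assoc, ← assoc (Hom.map .U (gR _)), ← hR, id_comp, h₁]
        have h₅ : (pR _ ⊙ Hom.map .U (Hom.map .R i)) ⊙
            (Hom.map .U (Hom.map .R j) ⊙ Hom.map .U (gR Z)) = Hom.id E _ := by
          rw [assoc, comp_of_eq h₂]; simp
        exact ⟨_, hY, _, _, h₄, h₅⟩

/-- By faithfulness of `U` it suffices to compare arrows between words ending in `b`, which are
isomorphic to reduced ones. -/
theorem hom_subsingleton_of_inv (hL : ∀ Z : Word s .a, InvL E Z) (hR : ∀ Z : Word s .a, InvR E Z)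
    {X Y : Word s t} (f g : Hom E X Y) : f = g := by
  have key : f.up = g.up := by
    obtain ⟨X', hX', i, j, hji, -⟩ := exists_iso_reduced hL hR X
    obtain ⟨Y', hY', k, l, hlk, -⟩ := exists_iso_reduced hL hR Y
    have h : k ⊙ f.up ⊙ j = k ⊙ g.up ⊙ j := hX'.hom_subsingleton hY' _ _
    rw [← comp_id f.up, ← comp_id g.up, ← id_comp (f.up ⊙ _), ← id_comp (g.up ⊙ _), ← hji, ← hlk,
      assoc, assoc, ← assoc f.up, ← assoc g.up, ← assoc k, h, assoc k]
  cases t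
  · exact map_U_injective key
  · exact key

/-! ### Composition with canonical functors on the right -/

/-- A set of equations closed, up to derivability, under composition with canonical functors on
the right. -/
def Stable (E : ArrEqSet) : Prop :=
  ∀ ⦃r s t : Side⦄ ⦃X Y : Word s t⦄ ⦃f g : Arr X Y⦄ (W : Word r s), E f g →
    Derives E (f.append W) (g.append W)

theorem Derives.append (hE : Stable E) {r : Side} {X Y : Word s t} {f g : Arr X Y}
    (h : Derives E f g) : ∀ W : Word r s, Derives E (f.append W) (g.append W) := by
  induction h with
  | ax h => exact fun W => hE W h
  | refl f => exact fun W => .refl _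
  | symm _ ih => exact fun W => .symm (ih W)
  | trans _ _ ih₁ ih₂ => exact fun W => .trans (ih₁ W) (ih₂ W)
  | comp_congr _ _ ih₁ ih₂ => exact fun W => .comp_congr (ih₁ W) (ih₂ W)
  | map_congr F _ ih => exact fun W => .map_congr F (ih W)
  | comp_id f => exact fun W => .comp_id _
  | id_comp f => exact fun W => .id_comp _
  | assoc h g f => exact fun W => .assoc _ _ _
  | map_id F X => exact fun W => .map_id F _
  | map_comp F g f => exact fun W => .map_comp F _ _
  | phiL_nat f => exact fun W => .phiL_nat _
  | gammaL_nat f => exact fun W => .gammaL_nat _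
  | phiR_nat f => exact fun W => .phiR_nat _
  | gammaR_nat f => exact fun W => .gammaR_nat _
  | triangle_L X => exact fun W => .triangle_L _
  | triangle_UL X => exact fun W => .triangle_UL _
  | triangle_UR X => exact fun W => .triangle_UR _
  | triangle_R X => exact fun W => .triangle_R _

theorem Word.append_append {q r : Side} (X : Word s t) (Z : Word r s) (W : Word q r) :
    (X.append Z).append W = X.append (Z.append W) := by
  induction X with
  | nil => rfl
  | cons F X ih => exact congrArg (Word.cons F) ih

theorem Arr.append_append {q r : Side} {X Y : Word s t} (f : Arr X Y) (Z : Word r s)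
    (W : Word q r) : HEq ((f.append Z).append W) (f.append (Z.append W)) := by
  induction f with
  | id X =>
    show HEq (Arr.id ((X.append Z).append W)) (Arr.id (X.append (Z.append W)))
    rw [Word.append_append]
  | @comp t X Y Z' g f ihg ihf =>
    simp only [Arr.append]
    congr 1 <;> exact Word.append_append ..
  | map F f ih =>
    simp only [Arr.append]
    congr 1 <;> exact Word.append_append ..
  | phiL X =>
    show HEq (Arr.phiL ((X.append Z).append W)) (Arr.phiL (X.append (Z.append W)))
    rw [Word.append_append]
  | gammaL X =>
    show HEq (Arr.gammaL ((X.append Z).append W)) (Arr.gammaL (X.append (Z.append W)))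
    rw [Word.append_append]
  | phiR X =>
    show HEq (Arr.phiR ((X.append Z).append W)) (Arr.phiR (X.append (Z.append W)))
    rw [Word.append_append]
  | gammaR X =>
    show HEq (Arr.gammaR ((X.append Z).append W)) (Arr.gammaR (X.append (Z.append W)))
    rw [Word.append_append]

theorem Derives.of_heq {X Y X' Y' : Word s t} {f g : Arr X Y} {f' g' : Arr X' Y'} (hX : X = X')
    (hY : Y = Y') (hf : HEq f f') (hg : HEq g g') (h : Derives E f' g') : Derives E f g := by
  subst hX hY
  cases hf
  cases hg
  exact h

/-- Universally assumed equations are stable: appending two words in turn amounts to appending their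
concatenation. -/
theorem stable_universal {X Y : Word s t} (f g : Arr X Y) : Stable (Universal f g) := by
  rintro q r t X Y _ _ W ⟨Z⟩
  exact .of_heq (Word.append_append ..) (Word.append_append ..) (f.append_append Z W)
    (g.append_append Z W) (.ax (.inst _))

theorem Collapse.hom_subsingleton (hE : Stable E) (h : Collapse E) {X Y : Word s t}
    (f g : Hom E X Y) : f = g := by
  have hL : InvL E (.nil : Word .a .a) → ∀ {s} (Z : Word s .a), InvL E Z := fun h s Z =>
    mk_eq_mk.2 (Derives.append hE (mk_eq_mk.1 (show mk E (.id _) =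
      mk E (.comp (.gammaL _) (.map .U (.phiL _))) from h)) Z)
  have hR : InvR E (.nil : Word .a .a) → ∀ {s} (Z : Word s .a), InvR E Z := fun h s Z =>
    mk_eq_mk.2 (Derives.append hE (mk_eq_mk.1 (show mk E (.id _) =
      mk E (.comp (.map .U (.gammaR _)) (.phiR _)) from h)) Z)
  obtain h | h := h
  · exact hom_subsingleton_of_inv (hL h) (invR_of_invL (hL h)) f g
  · exact hom_subsingleton_of_inv (invL_of_invR (hR h)) (hR h) f g

/-- The code of the composite with a canonical functor on the right: the new letters are kept. -/
def Cap.append {r : Side} : ∀ {t : Side} {X Z : Word s t}, Cap X Z → ∀ W : Word r s,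
    Cap (X.append W) (Z.append W)
  | _, _, _, .nil, W => Cap.id W
  | _, _, _, .map F e, W => .map F (e.append W)
  | _, _, _, .capL e, W => .capL (e.append W)
  | _, _, _, .capU e, W => .capU (e.append W)

/-- The code of the composite with a canonical functor on the right: the new letters are kept. -/
def Cup.append {r : Side} : ∀ {t : Side} {Z Y : Word s t}, Cup Z Y → ∀ W : Word r s,
    Cup (Z.append W) (Y.append W)
  | _, _, _, .nil, W => Cup.id W
  | _, _, _, .map F c, W => .map F (c.append W)
  | _, _, _, .cupU c, W => .cupU (c.append W)
  | _, _, _, .cupR c, W => .cupR (c.append W)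

theorem Cap.hom_append {r : Side} {X Z : Word s t} (e : Cap X Z) (W : Word r s) :
    (e.append W).hom E = mk E (e.toArr.append W) := by
  induction e with
  | nil => exact Cap.hom_id W
  | map F e ih => exact congrArg (Hom.map F) ih
  | capL e ih => exact congrArg (fun f => pL _ ⊙ Hom.map .L f) ih
  | capU e ih => exact congrArg (fun f => pR _ ⊙ Hom.map .U f) ih

theorem Cup.hom_append {r : Side} {Z Y : Word s t} (c : Cup Z Y) (W : Word r s) :
    (c.append W).hom E = mk E (c.toArr.append W) := by
  induction c with
  | nil => exact Cup.hom_id W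
  | map F c ih => exact congrArg (Hom.map F) ih
  | cupU c ih => exact congrArg (fun f => Hom.map .U f ⊙ gL _) ih
  | cupR c ih => exact congrArg (fun f => Hom.map .R f ⊙ gR _) ih

theorem Cap.append_injective {r : Side} (W : Word r s) {X Z : Word s t} (e : Cap X Z) :
    ∀ e' : Cap X Z, e.append W = e'.append W → e = e' := by
  induction e with
  | nil => rintro ⟨⟩ _; rfl
  | map F e ih =>
    intro e' h
    cases e' with
    | map _ e' =>
      rw [ih e' (by injection h)]
    | capL e' => simp [Cap.append] at h
    | capU e' => simp [Cap.append] at h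
  | capL e ih =>
    intro e' h
    cases e' with
    | map _ e' => simp [Cap.append] at h
    | capL e' =>
      rw [ih e' (by injection h)]
  | capU e ih =>
    intro e' h
    cases e' with
    | map _ e' => simp [Cap.append] at h
    | capU e' =>
      rw [ih e' (by injection h)]

theorem Cup.append_injective {r : Side} (W : Word r s) {Z Y : Word s t} (c : Cup Z Y) :
    ∀ c' : Cup Z Y, c.append W = c'.append W → c = c' := by
  induction c with
  | nil => rintro ⟨⟩ _; rfl
  | map F c ih =>
    intro c' h
    cases c' with
    | map _ c' =>
      rw [ih c' (by injection h)]
    | cupU c' => simp [Cup.append] at h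
    | cupR c' => simp [Cup.append] at h
  | cupU c ih =>
    intro c' h
    cases c' with
    | map _ c' => simp [Cup.append] at h
    | cupU c' =>
      rw [ih c' (by injection h)]
  | cupR c ih =>
    intro c' h
    cases c' with
    | map _ c' => simp [Cup.append] at h
    | cupR c' =>
      rw [ih c' (by injection h)]

theorem Word.len_append {r : Side} (X : Word s t) (W : Word r s) :
    (X.append W).len = X.len + W.len := by
  induction X with
  | nil => exact (Nat.zero_add _).symm
  | cons F X ih => simp only [Word.append, Word.len, ih]; omega

theorem Word.append_injective {r : Side} (W : Word r s) {X : Word s t} :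
    ∀ {X' : Word s t}, X.append W = X'.append W → X = X' := by
  induction X with
  | nil =>
    intro X' h
    cases X' with
    | nil => rfl
    | cons F X' =>
      have := congrArg Word.len h
      simp only [Word.append, Word.len, Word.len_append] at this
      omega
  | cons F X ih =>
    intro X' h
    cases X' with
    | nil =>
      have := congrArg Word.len h
      simp only [Word.append, Word.len, Word.len_append] at this
      omega
    | cons F' X' =>
      simp only [Word.append, Word.cons.injEq] at h
      obtain ⟨rfl, h₁, h₂⟩ := h
      rw [eq_of_heq h₁, ih (eq_of_heq h₂)]

/-- The normal form of the composite with a canonical functor on the right. -/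
def NF.append {r : Side} {X Y : Word s t} (n : NF X Y) (W : Word r s) :
    NF (X.append W) (Y.append W) :=
  ⟨n.1.append W, n.2.1.append W, n.2.2.append W⟩

theorem NF.hom_append {r : Side} {X Y : Word s t} (n : NF X Y) {f : Arr X Y} (hE : Stable E)
    (h : n.hom E = mk E f) (W : Word r s) : (n.append W).hom E = mk E (f.append W) := by
  have h₁ : mk E ((n.2.2.toArr.append W).comp (n.2.1.toArr.append W)) = mk E (f.append W) :=
    mk_eq_mk.2 (Derives.append hE (mk_eq_mk.1 (show mk E (.comp _ _) = _ from h)) W)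
  rw [← h₁]
  simp only [NF.hom, NF.append, Cap.hom_append, Cup.hom_append]
  rfl

theorem NF.append_injective {r : Side} (W : Word r s) {X Y : Word s t} {n n' : NF X Y}
    (h : n.append W = n'.append W) : n = n' := by
  obtain ⟨Z, e, c⟩ := n
  obtain ⟨Z', e', c'⟩ := n'
  simp only [NF.append, Sigma.mk.injEq] at h
  obtain rfl := Word.append_injective W h.1
  have h := eq_of_heq h.2
  rw [e.append_injective W e' (congrArg Prod.fst h), c.append_injective W c' (congrArg Prod.snd h)]

theorem NF.map_U_injective {X Y : Word s .a} {n n' : NF X Y}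
    (h : (⟨_, .map .U n.2.1, .map .U n.2.2⟩ : NF (.cons .U X) (.cons .U Y)) =
      ⟨_, .map .U n'.2.1, .map .U n'.2.2⟩) : n = n' := by
  obtain ⟨Z, e, c⟩ := n
  obtain ⟨Z', e', c'⟩ := n'
  simp only [Sigma.mk.injEq, Word.cons.injEq] at h
  obtain ⟨⟨-, -, h₁⟩, h₂⟩ := h
  cases h₁
  simp only [heq_eq_eq, Prod.mk.injEq] at h₂
  obtain ⟨h₂, h₃⟩ := h₂
  cases h₂
  cases h₃
  rfl

/-- Maximality: a new equation between canonical arrow terms, universally assumed, yields all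
equations between canonical arrow terms. -/
theorem derives_universal {X Y : Word s t} {f g : Arr X Y} (h : ¬ Derives Free f g)
    {s' t' : Side} {X' Y' : Word s' t'} (p q : Arr X' Y') : Derives (Universal f g) p q := by
  obtain ⟨n, hn⟩ := exists_nf f
  obtain ⟨n', hn'⟩ := exists_nf g
  have hne : n ≠ n' := by
    rintro rfl
    exact h (mk_eq_mk.1 ((hn _).symm.trans (hn' _)))
  obtain ⟨W⟩ : Nonempty (Word .a s) := by
    cases s
    exacts [⟨.nil⟩, ⟨.cons .U .nil⟩]
  have hE := stable_universal f g
  have h₁ : (n.append W).hom (Universal f g) = (n'.append W).hom (Universal f g) := by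
    rw [n.hom_append hE (hn _) W, n'.hom_append hE (hn' _) W]
    exact mk_eq_mk.2 (.ax (.inst W))
  refine mk_eq_mk.1 (Collapse.hom_subsingleton hE ?_ (mk _ p) (mk _ q))
  have h₂ : n.append W ≠ n'.append W := fun h => hne (NF.append_injective W h)
  cases t
  · refine (NF.collapse_or_eq ⟨_, .map .U (n.append W).2.1, .map .U (n.append W).2.2⟩
      ⟨_, .map .U (n'.append W).2.1, .map .U (n'.append W).2.2⟩ ?_).resolve_right
      (fun h => h₂ (NF.map_U_injective h))
    simp only [NF.hom, Cap.hom_map, Cup.hom_map, ← map_comp] at h₁ ⊢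
    rw [h₁]
  · exact (NF.collapse_or_eq _ _ h₁).resolve_right h₂


/-! ### A relational model -/

/-- Assignments of truth values to the letters of a word. -/
def Val : ∀ {t : Side}, Word s t → Type
  | _, .nil => Unit
  | _, .cons _ X => Bool × Val X

/-- The relation between assignments denoted by a canonical arrow term: the matched letters have
equal values. -/
def sem : ∀ {t : Side} {X Y : Word s t}, Arr X Y → Val X → Val Y → Prop
  | _, _, _, .id _ => fun x y => x = y
  | _, _, _, .comp g f => fun x z => ∃ y, sem f x y ∧ sem g y z
  | _, _, _, .map _ f => fun x y => x.1 = y.1 ∧ sem f x.2 y.2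
  | _, _, _, .phiL _ => fun x y => x.1 = x.2.1 ∧ x.2.2 = y
  | _, _, _, .gammaL _ => fun x y => y.1 = y.2.1 ∧ x = y.2.2
  | _, _, _, .phiR _ => fun x y => x.1 = x.2.1 ∧ x.2.2 = y
  | _, _, _, .gammaR _ => fun x y => y.1 = y.2.1 ∧ x = y.2.2

/-- The relational model is sound for trijunctions. -/
theorem sem_eq_of_derives {X Y : Word s t} {f g : Arr X Y} (h : Derives Free f g) :
    ∀ x y, sem f x y ↔ sem g x y := by
  induction h with
  | ax h => exact h.elim
  | refl f => exact fun _ _ => .rfl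
  | symm _ ih => exact fun x y => (ih x y).symm
  | trans _ _ ih₁ ih₂ => exact fun x y => (ih₁ x y).trans (ih₂ x y)
  | comp_congr _ _ ih₁ ih₂ => intro x y; simp [sem, ih₁, ih₂]
  | map_congr F _ ih => intro x y; simp [sem, ih]
  | comp_id f => intro x y; simp [sem]
  | id_comp f => intro x y; simp [sem]
  | assoc h g f =>
    intro x y
    simp only [sem]
    exact ⟨fun ⟨b, ⟨a, h₁, h₂⟩, h₃⟩ => ⟨a, h₁, b, h₂, h₃⟩,
      fun ⟨a, h₁, b, h₂, h₃⟩ => ⟨b, ⟨a, h₁, h₂⟩, h₃⟩⟩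
  | map_id F X => intro x y; exact Prod.ext_iff.symm
  | map_comp F g f =>
    rintro ⟨x₁, x⟩ ⟨y₁, y⟩
    simp only [sem]
    exact ⟨fun ⟨h, b, h₁, h₂⟩ => ⟨(x₁, b), ⟨rfl, h₁⟩, h, h₂⟩,
      fun ⟨b, ⟨h₁, h₂⟩, h₃, h₄⟩ => ⟨h₁.trans h₃, b.2, h₂, h₄⟩⟩
  | phiL_nat f =>
    rintro ⟨x₁, x₂, x⟩ y
    simp [sem, Val, and_assoc]
    exact and_comm
  | gammaL_nat f =>
    rintro x ⟨y₁, y₂, y⟩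
    simp [sem, Val, and_assoc]
    exact and_comm
  | phiR_nat f =>
    rintro ⟨x₁, x₂, x⟩ y
    simp [sem, Val, and_assoc]
    exact and_comm
  | gammaR_nat f =>
    rintro x ⟨y₁, y₂, y⟩
    simp [sem, Val, and_assoc]
    exact and_comm
  | triangle_L X =>
    rintro ⟨x₁, x⟩ ⟨y₁, y⟩
    simp [sem, Val, and_assoc]
  | triangle_UL X =>
    rintro ⟨x₁, x⟩ ⟨y₁, y⟩
    simp [sem, Val, and_assoc]
    exact fun _ => eq_comm
  | triangle_UR X =>
    rintro ⟨x₁, x⟩ ⟨y₁, y⟩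
    simp [sem, Val, and_assoc]
  | triangle_R X =>
    rintro ⟨x₁, x⟩ ⟨y₁, y⟩
    simp [sem, Val, and_assoc]
    exact fun _ => eq_comm

end Trijunction

/-! ### Commutative squares of arrow terms -/

section Square
variable {P : Modality → Modality → Type} {R : EqSet P}

theorem Derives.square_comp {A B C A' B' C' : Modality} {d : Term P A A'} {d' : Term P B B'}
    {d'' : Term P C C'} {f : Term P A B} {g : Term P B C} {f' : Term P A' B'} {g' : Term P B' C'}
    (hf : Derives R (d' ⊚ f) (f' ⊚ d)) (hg : Derives R (d'' ⊚ g) (g' ⊚ d')) :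
    Derives R (d'' ⊚ (g ⊚ f)) ((g' ⊚ f') ⊚ d) :=
  (Derives.assoc _ _ _).trans <| (Derives.comp_congr hg (.refl _)).trans <|
    (Derives.assoc _ _ _).symm.trans <| (Derives.comp_congr (.refl _) hf).trans <|
      Derives.assoc _ _ _

theorem Derives.square_id {A A' : Modality} (d : Term P A A') :
    Derives R (d ⊚ .id A) (.id A' ⊚ d) :=
  (Derives.comp_id d).trans (Derives.id_comp d).symm

theorem Derives.of_heq {A B A' B' : Modality} {f g : Term P A B} {f' g' : Term P A' B'}
    (hA : A' = A) (hB : B' = B) (hf : HEq f' f) (hg : HEq g' g) (h : Derives R f' g') :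
    Derives R f g := by
  subst hA hB
  cases hf
  cases hg
  exact h

theorem Derives.mono {R' : EqSet P} (hR : ∀ ⦃A B⦄ ⦃f g : Term P A B⦄, R f g → R' f g)
    {A B : Modality} {f g : Term P A B} (h : Derives R f g) : Derives R' f g := by
  induction h with
  | ax h => exact .ax (hR h)
  | refl f => exact .refl _
  | symm _ ih => exact .symm ih
  | trans _ _ ih₁ ih₂ => exact .trans ih₁ ih₂
  | comp_congr _ _ ih₁ ih₂ => exact .comp_congr ih₁ ih₂
  | map_congr M _ ih => exact .map_congr M ih
  | comp_id f => exact .comp_id _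
  | id_comp f => exact .id_comp _
  | assoc h g f => exact .assoc _ _ _
  | map_id M A => exact .map_id M _
  | map_comp M g f => exact .map_comp M _ _

theorem arrow_eq_arrow {A B : Modality} {f g : Term P A B} :
    arrow R f = arrow R g ↔ Derives R f g :=
  ⟨fun h => Quotient.exact h, fun h => Quotient.sound h⟩

theorem isThin_of_derives (h : ∀ {A B : Modality} (f g : Term P A B), Derives R f g) :
    Quiver.IsThin (SynCat R) := fun A B => ⟨fun f g => by
  induction f using Quotient.inductionOn with | h f =>
  induction g using Quotient.inductionOn with | h g =>
  exact Quotient.sound (h f g)⟩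

end Square

namespace S5

open Trijunction

/-! ### `S5` and trijunctions -/

/-- The functor `R` or `L` for which `U R` or `U L` is the given modal operator. -/
def fn : Mod → Fn .b .a
  | .box => .R
  | .dia => .L

/-- The canonical functor from `b` to `b` corresponding to a modality. -/
def word : Modality → Word .b .b
  | [] => .nil
  | M :: A => .cons .U (.cons (fn M) (word A))

/-- The canonical arrow term corresponding to a primitive arrow term of `S5`. -/
def primToArr : ∀ {A B : Modality}, Prim A B → Arr (word A) (word B)
  | _, _, .epsBox A => .phiR (word A)
  | _, _, .epsDia A => .gammaL (word A)
  | _, _, .delBox M A => .map .U (.gammaR (.cons (fn M) (word A)))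
  | _, _, .delDia M A => .map .U (.phiL (.cons (fn M) (word A)))

/-- The canonical arrow term corresponding to an arrow term of `S5`. -/
def toArr : ∀ {A B : Modality}, Term Prim A B → Arr (word A) (word B)
  | _, _, .id A => .id (word A)
  | _, _, .prim p => primToArr p
  | _, _, .comp g f => .comp (toArr g) (toArr f)
  | _, _, .map M f => .map .U (.map (fn M) (toArr f))

/-- The modality corresponding to a canonical functor `X` from `b`, or to `U X` when `X` ends in
`a`. -/
def modality : ∀ {t : Side}, Word .b t → Modality
  | _, .nil => []
  | _, .cons .U X => modality X
  | _, .cons .L X => .dia :: modality X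
  | _, .cons .R X => .box :: modality X

/-- The arrow term of `S5` corresponding to `U φL`. A word from `b` to `a` is not empty, and its
first letter decides which `δ` this is. -/
def ofPhiL : ∀ X : Word .b .a, Term Prim (.dia :: modality X) (modality X)
  | .cons .L X => delDia .dia (modality X)
  | .cons .R X => delDia .box (modality X)

/-- The arrow term of `S5` corresponding to `U γR`. -/
def ofGammaR : ∀ X : Word .b .a, Term Prim (modality X) (.box :: modality X)
  | .cons .L X => delBox .dia (modality X)
  | .cons .R X => delBox .box (modality X)

/-- The arrow term of `S5` corresponding to a canonical arrow term `f`, or to `U f` when `f` is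
between functors ending in `a`. -/
def ofArr : ∀ {t : Side} {X Y : Word .b t}, Arr X Y → Term Prim (modality X) (modality Y)
  | _, _, _, .id X => .id (modality X)
  | _, _, _, .comp g f => .comp (ofArr g) (ofArr f)
  | _, _, _, .map .U f => (ofArr f :)
  | _, _, _, .map .L f => .map .dia (ofArr f)
  | _, _, _, .map .R f => .map .box (ofArr f)
  | _, _, _, .phiL X => ofPhiL X
  | _, _, _, .gammaL X => epsDia (modality X)
  | _, _, _, .phiR X => epsBox (modality X)
  | _, _, _, .gammaR X => ofGammaR X

theorem modality_append_word (A : Modality) (Z : Word .b .b) :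
    modality ((word A).append Z) = A ++ modality Z := by
  induction A with
  | nil => rfl
  | cons M A ih => cases M <;> exact congrArg (List.cons _) ih

/-- Appending `Z` to a term and appending the modality of `Z` to its subscripts correspond to each
other, so that the translation preserves the universal assumption of equations. -/
theorem ofArr_append_toArr {A B : Modality} (f : Term Prim A B) (Z : Word .b .b) :
    HEq (ofArr ((toArr f).append Z)) (f.append Prim.shift (modality Z)) := by
  induction f with
  | id A =>
    show HEq (Term.id (modality ((word A).append Z))) (Term.id (A ++ modality Z))
    rw [modality_append_word]
  | prim p =>
    cases p with
    | epsBox =>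
      show HEq (epsBox (modality ((word _).append Z))) (epsBox (_ ++ modality Z))
      rw [modality_append_word]
    | epsDia =>
      show HEq (epsDia (modality ((word _).append Z))) (epsDia (_ ++ modality Z))
      rw [modality_append_word]
    | delBox M A =>
      cases M
      · show HEq (delBox .box (modality ((word A).append Z))) (delBox .box (A ++ modality Z))
        rw [modality_append_word]
      · show HEq (delBox .dia (modality ((word A).append Z))) (delBox .dia (A ++ modality Z))
        rw [modality_append_word]
    | delDia M A =>
      cases M
      · show HEq (delDia .box (modality ((word A).append Z))) (delDia .box (A ++ modality Z))
        rw [modality_append_word]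
      · show HEq (delDia .dia (modality ((word A).append Z))) (delDia .dia (A ++ modality Z))
        rw [modality_append_word]
  | @comp A B C g f ihg ihf =>
    have hA := modality_append_word A Z
    have hB := modality_append_word B Z
    have hC := modality_append_word C Z
    show HEq (Term.comp (ofArr ((toArr g).append Z)) (ofArr ((toArr f).append Z)))
      (Term.comp (g.append Prim.shift (modality Z)) (f.append Prim.shift (modality Z)))
    congr 1
  | @map M A B f ih =>
    have hA := modality_append_word A Z
    have hB := modality_append_word B Z
    have key : HEq (Term.map M (ofArr ((toArr f).append Z)))
      (Term.map M (f.append Prim.shift (modality Z))) := by congr 1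
    cases M <;> exact key

theorem modality_word (A : Modality) : modality (word A) = A := by
  induction A with
  | nil => rfl
  | cons M A ih => cases M <;> exact congrArg (List.cons _) ih

theorem ofArr_toArr {A B : Modality} (f : Term Prim A B) : HEq (ofArr (toArr f)) f := by
  induction f with
  | id A =>
    show HEq (Term.id (modality (word A))) (Term.id A)
    rw [modality_word]
  | prim p =>
    cases p with
    | epsBox =>
      show HEq (epsBox (modality (word _))) (epsBox _)
      rw [modality_word]
    | epsDia =>
      show HEq (epsDia (modality (word _))) (epsDia _)
      rw [modality_word]
    | delBox M A =>
      cases M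
      · show HEq (delBox .box (modality (word A))) (delBox .box A)
        rw [modality_word]
      · show HEq (delBox .dia (modality (word A))) (delBox .dia A)
        rw [modality_word]
    | delDia M A =>
      cases M
      · show HEq (delDia .box (modality (word A))) (delDia .box A)
        rw [modality_word]
      · show HEq (delDia .dia (modality (word A))) (delDia .dia A)
        rw [modality_word]
  | @comp A B C g f ihg ihf =>
    have hA := modality_word A
    have hB := modality_word B
    have hC := modality_word C
    show HEq (Term.comp (ofArr (toArr g)) (ofArr (toArr f)))
      (Term.comp g f)
    congr 1
  | @map M A B f ih =>
    have hA := modality_word A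
    have hB := modality_word B
    have key : HEq (Term.map M (ofArr (toArr f)))
      (Term.map M f) := by congr 1
    cases M <;> exact key

variable {R : EqSet Prim}

/-- Naturality of `φL` and `γR` with respect to the arrow terms of `S5` corresponding to canonical
arrow terms between functors ending in `a`. -/
def Natural (R : EqSet Prim) : ∀ {t : Side} {X Y : Word .b t}, Arr X Y → Prop
  | .a, X, Y, f =>
    Derives R (ofPhiL Y ⊚ .map .dia (ofArr f)) (ofArr f ⊚ ofPhiL X) ∧
      Derives R (ofGammaR Y ⊚ ofArr f) (.map .box (ofArr f) ⊚ ofGammaR X)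
  | .b, _, _, _ => True

/-- The Frobenius and (co)associativity equations are the naturality of `φL` and `γR` at `φL` and
`γR`. -/
theorem natural (hR : ∀ ⦃A B⦄ ⦃f g : Term Prim A B⦄, Ax f g → R f g) {t : Side}
    {X Y : Word .b t} (f : Arr X Y) : Natural R f := by
  induction f with
  | @id t X =>
    cases t
    · exact ⟨(Derives.comp_congr (.refl _) (.map_id _ _)).trans (.square_id _),
        (Derives.square_id _).trans (.comp_congr (.symm (.map_id _ _)) (.refl _))⟩
    · trivial
  | @comp t _ _ _ g f ihg ihf =>
    cases t
    · exact ⟨(Derives.comp_congr (.refl _) (.map_comp _ _ _)).trans (.square_comp ihf.1 ihg.1),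
        (Derives.square_comp ihf.2 ihg.2).trans (.comp_congr (.symm (.map_comp _ _ _)) (.refl _))⟩
    · trivial
  | map F f ih =>
    cases F with
    | U => trivial
    | L => exact ⟨.ax (hR (.delDia_nat .dia _)), .symm (.ax (hR (.delBox_nat .dia _)))⟩
    | R => exact ⟨.ax (hR (.delDia_nat .box _)), .symm (.ax (hR (.delBox_nat .box _)))⟩
  | phiL X =>
    cases X with | cons F X =>
    cases F with
    | L => exact ⟨.ax (hR (.delDia_delDia .dia _)), .symm (.ax (hR (.frob_N .dia _)))⟩
    | R => exact ⟨.ax (hR (.delDia_delDia .box _)), .symm (.ax (hR (.frob_N .box _)))⟩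
  | gammaL X => trivial
  | phiR X => trivial
  | gammaR X =>
    cases X with | cons F X =>
    cases F with
    | L => exact ⟨.ax (hR (.frob_I .dia _)), .symm (.ax (hR (.delBox_delBox .dia _)))⟩
    | R => exact ⟨.ax (hR (.frob_I .box _)), .symm (.ax (hR (.delBox_delBox .box _)))⟩

/-- The equations of trijunctions become equations of the modal category. -/
theorem derives_ofArr {E : ArrEqSet} (hR : ∀ ⦃A B⦄ ⦃f g : Term Prim A B⦄, Ax f g → R f g)
    (hE : ∀ ⦃t : Side⦄ ⦃X Y : Word .b t⦄ ⦃f g : Arr X Y⦄, E f g → Derives R (ofArr f) (ofArr g))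
    {t : Side} {X Y : Word .b t} {f g : Arr X Y} (h : Trijunction.Derives E f g) :
    Derives R (ofArr f) (ofArr g) := by
  induction h with
  | ax h => exact hE h
  | refl f => exact .refl _
  | symm _ ih => exact .symm ih
  | trans _ _ ih₁ ih₂ => exact .trans ih₁ ih₂
  | comp_congr _ _ ih₁ ih₂ => exact .comp_congr ih₁ ih₂
  | map_congr F _ ih =>
    cases F
    exacts [ih, .map_congr _ ih, .map_congr _ ih]
  | comp_id f => exact .comp_id _
  | id_comp f => exact .id_comp _
  | assoc h g f => exact .assoc _ _ _
  | map_id F X =>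
    cases F
    exacts [.refl _, .map_id _ _, .map_id _ _]
  | map_comp F g f =>
    cases F
    exacts [.refl _, .map_comp _ _ _, .map_comp _ _ _]
  | phiL_nat f => exact (natural hR f).1
  | gammaL_nat f => exact .ax (hR (.epsDia_nat _))
  | phiR_nat f => exact .ax (hR (.epsBox_nat _))
  | gammaR_nat f => exact .symm (natural hR f).2
  | triangle_L X => exact .ax (hR (.dia_eta _))
  | triangle_UL X =>
    cases X with | cons F X =>
    cases F
    exacts [.ax (hR (.dia_beta .dia _)), .ax (hR (.dia_beta .box _))]
  | triangle_UR X =>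
    cases X with | cons F X =>
    cases F
    exacts [.ax (hR (.box_beta .dia _)), .ax (hR (.box_beta .box _))]
  | triangle_R X => exact .ax (hR (.box_eta _))

/-- Derivability is reflected by the translation into trijunctions, since the translation back is
its left inverse. -/
theorem derives_of_toArr {E : ArrEqSet} (hR : ∀ ⦃A B⦄ ⦃f g : Term Prim A B⦄, Ax f g → R f g)
    (hE : ∀ ⦃t : Side⦄ ⦃X Y : Word .b t⦄ ⦃f g : Arr X Y⦄, E f g → Derives R (ofArr f) (ofArr g))
    {A B : Modality} {f g : Term Prim A B} (h : Trijunction.Derives E (toArr f) (toArr g)) :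
    Derives R f g :=
  .of_heq (modality_word A) (modality_word B) (ofArr_toArr f) (ofArr_toArr g) (derives_ofArr hR hE h)

/-- Maximality of `S5`. -/
theorem derives_ext_of_not_derives {A B : Modality} {f g : Term Prim A B}
    (h : ¬ Trijunction.Derives Free (toArr f) (toArr g)) {A' B' : Modality}
    (p q : Term Prim A' B') : Derives (Ext f g) p q := by
  refine derives_of_toArr (E := Trijunction.Universal (toArr f) (toArr g)) (fun _ _ _ _ => .inl)
    ?_ (derives_universal h (toArr p) (toArr q))
  rintro t X Y _ _ ⟨Z⟩
  exact .of_heq (modality_append_word A Z).symm (modality_append_word B Z).symm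
    (ofArr_append_toArr f Z).symm (ofArr_append_toArr g Z).symm
    (.ax (.inr (.inst (modality Z))))

theorem not_derives_toArr {A B : Modality} {f g : Term Prim A B} (h : ¬ Derives Ax f g) :
    ¬ Trijunction.Derives Free (toArr f) (toArr g) :=
  fun h' => h (derives_of_toArr (fun _ _ _ _ => id) (fun _ _ _ _ _ h => h.elim) h')

/-- A preordering equation yields all equations if its two terms, at the empty modality, denote
different relations in the model. -/
theorem derives_triv_of_sem {i : Fin 6} {A B : Modality} {f g : Term Prim A B}
    (x : Val (word A)) (y : Val (word B)) (hf : sem (toArr f) x y) (hg : ¬ sem (toArr g) x y)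
    (hi : ∀ C, Preordering i (f.append Prim.shift C) (g.append Prim.shift C))
    {A' B' : Modality} (p q : Term Prim A' B') : Derives (Triv i) p q := by
  refine Derives.mono ?_ (derives_ext_of_not_derives
    (fun h => hg ((sem_eq_of_derives h x y).1 hf)) p q)
  intro _ _ _ _ h
  obtain h | h := h
  · exact .inl h
  · cases h with
    | inst C => exact .inr (hi C)

/-- Each preordering equation is refuted in the model by the assignments given below. -/
theorem derives_triv (i : Fin 6) {A B : Modality} (p q : Term Prim A B) : Derives (Triv i) p q := by
  fin_cases i
  · refine derives_triv_of_sem (f := .map .box (epsBox [])) (g := epsBox [.box])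
      (true, true, false, false, ()) (true, true, ()) ?_ ?_ (fun C => Preordering.e0 C) p q <;>
    simp [toArr, primToArr, sem, word, fn, Val]
  · refine derives_triv_of_sem (f := epsBox [] ⊚ epsBox [.box] ⊚ delDia .box [.box])
      (g := epsBox [] ⊚ delDia .box [] ⊚ .map .dia (epsBox [.box]))
      (true, false, false, true, true, true, ()) () ?_ ?_ (fun C => Preordering.e1 C) p q <;>
    simp [toArr, primToArr, sem, word, fn, Val]
  · refine derives_triv_of_sem (f := .map .box (epsDia []))
      (g := delBox .dia [] ⊚ epsDia [] ⊚ epsBox [])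
      (true, false, ()) (true, false, true, true, ()) ?_ ?_ (fun C => Preordering.e2 C) p q <;>
    simp [toArr, primToArr, sem, word, fn, Val]
  · refine derives_triv_of_sem (f := epsDia [] ⊚ epsBox [] ⊚ delDia .box [])
      (g := .map .dia (epsBox []))
      (true, false, false, true, ()) (true, true, ()) ?_ ?_ (fun C => Preordering.e3 C) p q <;>
    simp [toArr, primToArr, sem, word, fn, Val]
  · refine derives_triv_of_sem (f := .map .box (epsDia [.dia]) ⊚ delBox .dia [] ⊚ epsDia [])
      (g := delBox .dia [.dia] ⊚ epsDia [.dia] ⊚ epsDia [])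
      () (true, false, true, true, false, true, ()) ?_ ?_ (fun C => Preordering.e4 C) p q <;>
    simp [toArr, primToArr, sem, word, fn, Val]
  · refine derives_triv_of_sem (f := epsDia [.dia]) (g := .map .dia (epsDia []))
      (true, false, ()) (true, true, true, false, ()) ?_ ?_ (fun C => Preordering.e5 C) p q <;>
    simp [toArr, primToArr, sem, word, fn, Val]

end S5

namespace FiveS

open Trijunction

/-! ### `5S` and trijunctions -/

/-- The functor `L` or `R` for which `L U` or `R U` is the given modal operator. -/
def fn : Mod → Fn .b .a
  | .box => .L
  | .dia => .R

/-- The canonical functor from `a` to `a` corresponding to a modality. -/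
def word : Modality → Word .a .a
  | [] => .nil
  | M :: A => .cons (fn M) (.cons .U (word A))

/-- The canonical arrow term corresponding to a primitive arrow term of `5S`. -/
def primToArr : ∀ {A B : Modality}, Prim A B → Arr (word A) (word B)
  | _, _, .epsBox A => .phiL (word A)
  | _, _, .epsDia A => .gammaR (word A)
  | _, _, .sigBox M A => .map (fn M) (.gammaL (.cons .U (word A)))
  | _, _, .sigDia M A => .map (fn M) (.phiR (.cons .U (word A)))

/-- The canonical arrow term corresponding to an arrow term of `5S`. -/
def toArr : ∀ {A B : Modality}, Term Prim A B → Arr (word A) (word B)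
  | _, _, .id A => .id (word A)
  | _, _, .prim p => primToArr p
  | _, _, .comp g f => .comp (toArr g) (toArr f)
  | _, _, .map M f => .map (fn M) (.map .U (toArr f))

/-- The modality corresponding to a canonical functor `X` from `a`. When `X` ends in `b`, it
begins with `U`, which is deleted. -/
def modality : ∀ {t : Side}, Word .a t → Modality
  | _, .nil => []
  | _, .cons .U X => modality X
  | _, .cons .L X => .box :: modality X
  | _, .cons .R X => .dia :: modality X

/-- Arrow terms or, for functors ending in `b`, pairs of arrow terms: those obtained by applying
`L` and `R`. -/
def TermAt : Side → Modality → Modality → Type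
  | .a, A, B => Term Prim A B
  | .b, A, B => ∀ M, Term Prim (M :: A) (M :: B)

/-- The arrow term of `5S` corresponding to a canonical arrow term `f`, or to `L f` and `R f` when
`f` is between functors ending in `b`. -/
def ofArr : ∀ {t : Side} {X Y : Word .a t}, Arr X Y → TermAt t (modality X) (modality Y)
  | .a, _, _, .id X => .id (modality X)
  | .b, _, _, .id X => fun M => .id (M :: modality X)
  | .a, _, _, .comp g f => .comp (ofArr g) (ofArr f)
  | .b, _, _, .comp g f => fun M => .comp (ofArr g M) (ofArr f M)
  | _, _, _, .map .U f => fun M => .map M (ofArr f)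
  | _, _, _, .map .L f => ofArr f .box
  | _, _, _, .map .R f => ofArr f .dia
  | _, _, _, .phiL X => epsBox (modality X)
  | _, _, _, .gammaL X => fun M => sigBox M (modality X)
  | _, _, _, .phiR X => fun M => sigDia M (modality X)
  | _, _, _, .gammaR X => epsDia (modality X)

theorem modality_append_word (A : Modality) (Z : Word .a .a) :
    modality ((word A).append Z) = A ++ modality Z := by
  induction A with
  | nil => rfl
  | cons M A ih => cases M <;> exact congrArg (List.cons _) ih

/-- Appending `Z` to a term and appending the modality of `Z` to its subscripts correspond to each
other, so that the translation preserves the universal assumption of equations. -/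
theorem ofArr_append_toArr {A B : Modality} (f : Term Prim A B) (Z : Word .a .a) :
    HEq (ofArr ((toArr f).append Z)) (f.append Prim.shift (modality Z)) := by
  induction f with
  | id A =>
    show HEq (Term.id (modality ((word A).append Z))) (Term.id (A ++ modality Z))
    rw [modality_append_word]
  | prim p =>
    cases p with
    | epsBox =>
      show HEq (epsBox (modality ((word _).append Z))) (epsBox (_ ++ modality Z))
      rw [modality_append_word]
    | epsDia =>
      show HEq (epsDia (modality ((word _).append Z))) (epsDia (_ ++ modality Z))
      rw [modality_append_word]
    | sigBox M A =>
      cases M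
      · show HEq (sigBox .box (modality ((word A).append Z))) (sigBox .box (A ++ modality Z))
        rw [modality_append_word]
      · show HEq (sigBox .dia (modality ((word A).append Z))) (sigBox .dia (A ++ modality Z))
        rw [modality_append_word]
    | sigDia M A =>
      cases M
      · show HEq (sigDia .box (modality ((word A).append Z))) (sigDia .box (A ++ modality Z))
        rw [modality_append_word]
      · show HEq (sigDia .dia (modality ((word A).append Z))) (sigDia .dia (A ++ modality Z))
        rw [modality_append_word]
  | @comp A B C g f ihg ihf =>
    have hA := modality_append_word A Z
    have hB := modality_append_word B Z
    have hC := modality_append_word C Z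
    show HEq (Term.comp (ofArr ((toArr g).append Z)) (ofArr ((toArr f).append Z)))
      (Term.comp (g.append Prim.shift (modality Z)) (f.append Prim.shift (modality Z)))
    congr 1
  | @map M A B f ih =>
    have hA := modality_append_word A Z
    have hB := modality_append_word B Z
    have key : HEq (Term.map M (ofArr ((toArr f).append Z)))
      (Term.map M (f.append Prim.shift (modality Z))) := by congr 1
    cases M <;> exact key

theorem modality_word (A : Modality) : modality (word A) = A := by
  induction A with
  | nil => rfl
  | cons M A ih => cases M <;> exact congrArg (List.cons _) ih

theorem ofArr_toArr {A B : Modality} (f : Term Prim A B) : HEq (ofArr (toArr f)) f := by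
  induction f with
  | id A =>
    show HEq (Term.id (modality (word A))) (Term.id A)
    rw [modality_word]
  | prim p =>
    cases p with
    | epsBox =>
      show HEq (epsBox (modality (word _))) (epsBox _)
      rw [modality_word]
    | epsDia =>
      show HEq (epsDia (modality (word _))) (epsDia _)
      rw [modality_word]
    | sigBox M A =>
      cases M
      · show HEq (sigBox .box (modality (word A))) (sigBox .box A)
        rw [modality_word]
      · show HEq (sigBox .dia (modality (word A))) (sigBox .dia A)
        rw [modality_word]
    | sigDia M A =>
      cases M
      · show HEq (sigDia .box (modality (word A))) (sigDia .box A)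
        rw [modality_word]
      · show HEq (sigDia .dia (modality (word A))) (sigDia .dia A)
        rw [modality_word]
  | @comp A B C g f ihg ihf =>
    have hA := modality_word A
    have hB := modality_word B
    have hC := modality_word C
    show HEq (Term.comp (ofArr (toArr g)) (ofArr (toArr f)))
      (Term.comp g f)
    congr 1
  | @map M A B f ih =>
    have hA := modality_word A
    have hB := modality_word B
    have key : HEq (Term.map M (ofArr (toArr f)))
      (Term.map M f) := by congr 1
    cases M <;> exact key

variable {R : EqSet Prim}

section Derived

/-- An arrow term as an arrow of the category axiomatized by `R`. -/
def hom (R : EqSet Prim) {A B : Modality} (f : Term Prim A B) : (⟨A⟩ : SynCat R) ⟶ ⟨B⟩ :=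
  arrow R f

theorem hom_comp {A B C : Modality} (g : Term Prim B C) (f : Term Prim A B) :
    hom R (g ⊚ f) = hom R f ≫ hom R g := rfl

theorem hom_eq_hom {A B : Modality} {f g : Term Prim A B} :
    hom R f = hom R g ↔ Derives R f g := arrow_eq_arrow

theorem hom_map_comp (M : Mod) {A B C : Modality} (g : Term Prim B C) (f : Term Prim A B) :
    hom R (.map M f) ≫ hom R (.map M g) = hom R (.map M (g ⊚ f)) :=
  (hom_eq_hom.2 (.map_comp M g f)).symm

/-- The arrow `sigBox dia` is a transpose of `sigDia box`. The unit of the adjunction between `box`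
and `dia` is the composite of `epsDia` and `sigBox dia`. -/
theorem sigBox_eq (hR : ∀ ⦃A B⦄ ⦃f g : Term Prim A B⦄, Ax f g → R f g) (A : Modality) :
    hom R (sigBox .dia A) =
      hom R (epsDia (.dia :: A)) ≫ hom R (sigBox .dia (.dia :: A)) ≫
        hom R (.map .dia (sigDia .box A)) := by
  have h₁ : hom R (sigBox .dia (.dia :: A)) ≫ hom R (.map .dia (sigDia .box A)) =
    hom R (sigDia .dia A) ≫ hom R (sigBox .dia A) := hom_eq_hom.2 (.ax (hR (.frob_N .dia A)))
  have h₂ : hom R (epsDia (.dia :: A)) ≫ hom R (sigDia .dia A) = 𝟙 _ :=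
    hom_eq_hom.2 (.ax (hR (.dia_beta A)))
  rw [h₁, ← Category.assoc, h₂, Category.id_comp]

/-- The arrow `sigDia box` is a transpose of `sigBox dia`: the dual of `sigBox_eq`. -/
theorem sigDia_eq (hR : ∀ ⦃A B⦄ ⦃f g : Term Prim A B⦄, Ax f g → R f g) (A : Modality) :
    hom R (sigDia .box A) =
      hom R (.map .box (sigBox .dia A)) ≫ hom R (sigDia .box (.box :: A)) ≫
        hom R (epsBox (.box :: A)) := by
  have h₁ : hom R (.map .box (sigBox .dia A)) ≫ hom R (sigDia .box (.box :: A)) =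
    hom R (sigDia .box A) ≫ hom R (sigBox .box A) := hom_eq_hom.2 (.ax (hR (.frob_I .box A)))
  have h₂ : hom R (sigBox .box A) ≫ hom R (epsBox (.box :: A)) = 𝟙 _ :=
    hom_eq_hom.2 (.ax (hR (.box_beta A)))
  rw [← Category.assoc, h₁, Category.assoc, h₂, Category.comp_id]

/-- The coassociativity of `sigBox M`, which is an axiom only for `M = box`. For `M = dia` it is
the transpose of the former: by `sigBox_eq`, `sigBox dia` is obtained from `sigDia box` with the
unit of an adjunction between `box` and `dia`. -/
theorem sigBox_sigBox (hR : ∀ ⦃A B⦄ ⦃f g : Term Prim A B⦄, Ax f g → R f g) (M : Mod)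
    (A : Modality) : Derives R (sigBox M (.box :: A) ⊚ sigBox M A)
      (.map M (sigBox .box A) ⊚ sigBox M A) := by
  cases M with
  | box => exact .symm (.ax (hR (.sigBox_sigBox A)))
  | dia =>
    have h₁ : hom R (sigBox .dia A) ≫ hom R (epsDia (.dia :: .box :: A)) =
        hom R (epsDia (.dia :: A)) ≫ hom R (.map .dia (sigBox .dia A)) :=
      (hom_eq_hom.2 (.ax (hR (.epsDia_nat (sigBox .dia A))))).symm
    have h₂ : hom R (.map .dia (sigBox .dia A)) ≫ hom R (sigBox .dia (.dia :: .box :: A)) =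
        hom R (sigBox .dia (.dia :: A)) ≫ hom R (.map .dia (.map .box (sigBox .dia A))) :=
      (hom_eq_hom.2 (.ax (hR (.sigBox_nat .dia (sigBox .dia A))))).symm
    have h₃ : hom R (.map .dia (.map .box (sigBox .dia A))) ≫
        hom R (.map .dia (sigDia .box (.box :: A))) =
        hom R (.map .dia (sigDia .box A)) ≫ hom R (.map .dia (sigBox .box A)) := by
      rw [hom_map_comp, hom_map_comp]
      exact hom_eq_hom.2 (.map_congr _ (.ax (hR (.frob_I .box A))))
    rw [← hom_eq_hom, hom_comp, hom_comp, sigBox_eq hR (.box :: A), ← Category.assoc, h₁,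
      Category.assoc, ← Category.assoc (hom R (.map .dia (sigBox .dia A))), h₂, Category.assoc, h₃,
      sigBox_eq hR A]
    simp only [Category.assoc]

/-- The associativity of `sigDia M`, which is an axiom only for `M = dia`: the dual of
`sigBox_sigBox`. -/
theorem sigDia_sigDia (hR : ∀ ⦃A B⦄ ⦃f g : Term Prim A B⦄, Ax f g → R f g) (M : Mod)
    (A : Modality) : Derives R (sigDia M A ⊚ .map M (sigDia .dia A))
      (sigDia M A ⊚ sigDia M (.dia :: A)) := by
  cases M with
  | dia => exact .ax (hR (.sigDia_sigDia A))
  | box =>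
    have h₁ : hom R (epsBox (.box :: .dia :: A)) ≫ hom R (sigDia .box A) =
        hom R (.map .box (sigDia .box A)) ≫ hom R (epsBox (.box :: A)) :=
      (hom_eq_hom.2 (.ax (hR (.epsBox_nat (sigDia .box A))))).symm
    have h₂ : hom R (sigDia .box (.box :: .dia :: A)) ≫ hom R (.map .box (sigDia .box A)) =
        hom R (.map .box (.map .dia (sigDia .box A))) ≫ hom R (sigDia .box (.box :: A)) :=
      (hom_eq_hom.2 (.ax (hR (.sigDia_nat .box (sigDia .box A))))).symm
    have h₃ : hom R (.map .box (sigBox .dia (.dia :: A))) ≫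
        hom R (.map .box (.map .dia (sigDia .box A))) =
        hom R (.map .box (sigDia .dia A)) ≫ hom R (.map .box (sigBox .dia A)) := by
      rw [hom_map_comp, hom_map_comp]
      exact hom_eq_hom.2 (.map_congr _ (.ax (hR (.frob_N .dia A))))
    rw [← hom_eq_hom, hom_comp, hom_comp, sigDia_eq hR (.dia :: A), Category.assoc, Category.assoc,
      h₁, ← Category.assoc (hom R (sigDia .box _)), h₂, ← Category.assoc, ← Category.assoc, h₃,
      sigDia_eq hR A]
    simp only [Category.assoc]

end Derived

/-- Naturality of `γL` and `φR` with respect to the arrow terms of `5S` corresponding to canonical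
arrow terms between functors ending in `b`. -/
def Natural (R : EqSet Prim) : ∀ {t : Side} {X Y : Word .a t}, Arr X Y → Prop
  | .b, X, Y, f => ∀ M,
    Derives R (sigBox M (modality Y) ⊚ ofArr f M)
      (.map M (ofArr f .box) ⊚ sigBox M (modality X)) ∧
    Derives R (sigDia M (modality Y) ⊚ .map M (ofArr f .dia)) (ofArr f M ⊚ sigDia M (modality X))
  | .a, _, _, _ => True

/-- The Frobenius and (co)associativity equations are the naturality of `γL` and `φR` at `γL` and
`φR`. -/
theorem natural (hR : ∀ ⦃A B⦄ ⦃f g : Term Prim A B⦄, Ax f g → R f g) {t : Side}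
    {X Y : Word .a t} (f : Arr X Y) : Natural R f := by
  induction f with
  | @id t X =>
    cases t
    · trivial
    · exact fun M => ⟨(Derives.square_id _).trans (.comp_congr (.symm (.map_id _ _)) (.refl _)),
        (Derives.comp_congr (.refl _) (.map_id _ _)).trans (.square_id _)⟩
  | @comp t _ _ _ g f ihg ihf =>
    cases t
    · trivial
    · exact fun M => ⟨(Derives.square_comp (ihf M).1 (ihg M).1).trans
          (.comp_congr (.symm (.map_comp _ _ _)) (.refl _)),
        (Derives.comp_congr (.refl _) (.map_comp _ _ _)).trans
          (.square_comp (ihf M).2 (ihg M).2)⟩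
  | map F f ih =>
    cases F with
    | U => exact fun M => ⟨.symm (.ax (hR (.sigBox_nat M _))), .ax (hR (.sigDia_nat M _))⟩
    | L => trivial
    | R => trivial
  | phiL X => trivial
  | gammaL X => exact fun M => ⟨sigBox_sigBox hR M _, .ax (hR (.frob_I M _))⟩
  | phiR X => exact fun M => ⟨.symm (.ax (hR (.frob_N M _))), sigDia_sigDia hR M _⟩
  | gammaR X => trivial

/-- Derivability of equations between elements of `TermAt`. -/
def DerivesAt (R : EqSet Prim) : ∀ {t : Side} {A B : Modality}, TermAt t A B → TermAt t A B → Prop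
  | .a, _, _, f, g => Derives R f g
  | .b, _, _, f, g => ∀ M, Derives R (f M) (g M)

/-- The equations of trijunctions become equations of the modal category. -/
theorem derives_ofArr {E : ArrEqSet} (hR : ∀ ⦃A B⦄ ⦃f g : Term Prim A B⦄, Ax f g → R f g)
    (hE : ∀ ⦃t : Side⦄ ⦃X Y : Word .a t⦄ ⦃f g : Arr X Y⦄, E f g → DerivesAt R (ofArr f) (ofArr g))
    {t : Side} {X Y : Word .a t} {f g : Arr X Y} (h : Trijunction.Derives E f g) :
    DerivesAt R (ofArr f) (ofArr g) := by
  induction h with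
  | ax h => exact hE h
  | @refl t => cases t; exacts [.refl _, fun _ => .refl _]
  | @symm t _ _ _ _ _ ih => cases t; exacts [.symm ih, fun M => .symm (ih M)]
  | @trans t _ _ _ _ _ _ _ ih₁ ih₂ =>
    cases t; exacts [.trans ih₁ ih₂, fun M => .trans (ih₁ M) (ih₂ M)]
  | @comp_congr t _ _ _ _ _ _ _ _ _ ih₁ ih₂ =>
    cases t; exacts [.comp_congr ih₁ ih₂, fun M => .comp_congr (ih₁ M) (ih₂ M)]
  | map_congr F _ ih =>
    cases F
    exacts [fun M => .map_congr M ih, ih .box, ih .dia]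
  | @comp_id t => cases t; exacts [.comp_id _, fun _ => .comp_id _]
  | @id_comp t => cases t; exacts [.id_comp _, fun _ => .id_comp _]
  | @assoc t => cases t; exacts [.assoc _ _ _, fun _ => .assoc _ _ _]
  | map_id F X =>
    cases F
    exacts [fun _ => .map_id _ _, .refl _, .refl _]
  | map_comp F g f =>
    cases F
    exacts [fun _ => .map_comp _ _ _, .refl _, .refl _]
  | phiL_nat f => exact .ax (hR (.epsBox_nat _))
  | gammaL_nat f => exact fun M => .symm (natural hR f M).1
  | phiR_nat f => exact fun M => (natural hR f M).2
  | gammaR_nat f => exact .ax (hR (.epsDia_nat _))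
  | triangle_L X => exact .ax (hR (.box_beta _))
  | triangle_UL X => exact fun M => .ax (hR (.box_eta M _))
  | triangle_UR X => exact fun M => .ax (hR (.dia_eta M _))
  | triangle_R X => exact .ax (hR (.dia_beta _))

/-- Derivability is reflected by the translation into trijunctions, since the translation back is
its left inverse. -/
theorem derives_of_toArr {E : ArrEqSet} (hR : ∀ ⦃A B⦄ ⦃f g : Term Prim A B⦄, Ax f g → R f g)
    (hE : ∀ ⦃t : Side⦄ ⦃X Y : Word .a t⦄ ⦃f g : Arr X Y⦄, E f g → DerivesAt R (ofArr f) (ofArr g))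
    {A B : Modality} {f g : Term Prim A B} (h : Trijunction.Derives E (toArr f) (toArr g)) :
    Derives R f g :=
  .of_heq (modality_word A) (modality_word B) (ofArr_toArr f) (ofArr_toArr g) (derives_ofArr hR hE h)

/-- Maximality of `5S`. -/
theorem derives_ext_of_not_derives {A B : Modality} {f g : Term Prim A B}
    (h : ¬ Trijunction.Derives Free (toArr f) (toArr g)) {A' B' : Modality}
    (p q : Term Prim A' B') : Derives (Ext f g) p q := by
  refine derives_of_toArr (E := Trijunction.Universal (toArr f) (toArr g)) (fun _ _ _ _ => .inl)
    ?_ (derives_universal h (toArr p) (toArr q))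
  rintro t X Y _ _ ⟨Z⟩
  exact .of_heq (modality_append_word A Z).symm (modality_append_word B Z).symm
    (ofArr_append_toArr f Z).symm (ofArr_append_toArr g Z).symm
    (.ax (.inr (.inst (modality Z))))

theorem not_derives_toArr {A B : Modality} {f g : Term Prim A B} (h : ¬ Derives Ax f g) :
    ¬ Trijunction.Derives Free (toArr f) (toArr g) :=
  fun h' => h (derives_of_toArr (fun _ _ _ _ => id) (fun _ _ _ _ _ h => h.elim) h')

/-- A preordering equation yields all equations if its two terms, at the empty modality, denote
different relations in the model. -/
theorem derives_triv_of_sem {i : Fin 6} {A B : Modality} {f g : Term Prim A B}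
    (x : Val (word A)) (y : Val (word B)) (hf : sem (toArr f) x y) (hg : ¬ sem (toArr g) x y)
    (hi : ∀ C, Preordering i (f.append Prim.shift C) (g.append Prim.shift C))
    {A' B' : Modality} (p q : Term Prim A' B') : Derives (Triv i) p q := by
  refine Derives.mono ?_ (derives_ext_of_not_derives
    (fun h => hg ((sem_eq_of_derives h x y).1 hf)) p q)
  intro _ _ _ _ h
  obtain h | h := h
  · exact .inl h
  · cases h with
    | inst C => exact .inr (hi C)

/-- Each preordering equation is refuted in the model by the assignments given below. -/
theorem derives_triv (i : Fin 6) {A B : Modality} (p q : Term Prim A B) : Derives (Triv i) p q := by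
  fin_cases i
  · refine derives_triv_of_sem (f := .map .box (epsBox [])) (g := epsBox [.box])
      (true, true, false, false, ()) (true, true, ()) ?_ ?_ (fun C => Preordering.e0 C) p q <;>
    simp [toArr, primToArr, sem, word, fn, Val]
  · refine derives_triv_of_sem
      (f := epsBox [] ⊚ .map .box (epsBox []) ⊚ .map .box (sigDia .box []))
      (g := epsBox [] ⊚ sigDia .box [] ⊚ .map .box (epsBox [.dia]))
      (true, true, true, false, false, true, ()) () ?_ ?_ (fun C => Preordering.e1 C) p q <;>
    simp [toArr, primToArr, sem, word, fn, Val]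
  · refine derives_triv_of_sem (f := epsDia [.box])
      (g := sigBox .dia [] ⊚ epsDia [] ⊚ epsBox [])
      (true, false, ()) (true, true, true, false, ()) ?_ ?_ (fun C => Preordering.e2 C) p q <;>
    simp [toArr, primToArr, sem, word, fn, Val]
  · refine derives_triv_of_sem (f := epsDia [] ⊚ epsBox [] ⊚ sigDia .box [])
      (g := epsBox [.dia])
      (true, false, false, true, ()) (true, true, ()) ?_ ?_ (fun C => Preordering.e3 C) p q <;>
    simp [toArr, primToArr, sem, word, fn, Val]
  · refine derives_triv_of_sem
      (f := .map .dia (epsDia [.box]) ⊚ sigBox .dia [] ⊚ epsDia [])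
      (g := .map .dia (sigBox .dia []) ⊚ .map .dia (epsDia []) ⊚ epsDia [])
      () (true, false, true, true, false, true, ()) ?_ ?_ (fun C => Preordering.e4 C) p q <;>
    simp [toArr, primToArr, sem, word, fn, Val]
  · refine derives_triv_of_sem (f := epsDia [.dia]) (g := .map .dia (epsDia []))
      (true, false, ()) (true, true, true, false, ()) ?_ ?_ (fun C => Preordering.e5 C) p q <;>
    simp [toArr, primToArr, sem, word, fn, Val]

end FiveS
end Modal

/-! ### Maximality of `S5`, `5S` and trijunctions -/

namespace Modal

/-- Two axiomatizations that derive all equations define the same category. -/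
theorem sameCategory_of_derives {P : Modality → Modality → Type} {R R' : EqSet P}
    (h : ∀ {A B : Modality} (f g : Term P A B), Derives R f g)
    (h' : ∀ {A B : Modality} (f g : Term P A B), Derives R' f g) : SameCategory R R' :=
  fun _ _ p q => iff_of_true (arrow_eq_arrow.2 (h p q)) (arrow_eq_arrow.2 (h' p q))

end Modal

theorem mainTheorem2 :
    -- `S5`: the extensions with a preordering equation are preorders, and any extension with a
    -- new equation, universally assumed, is a preorder and coincides with each of them
    ((∀ i : Fin 6, Quiver.IsThin (Modal.SynCat (Modal.S5.Triv i))) ∧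
      ∀ (A B : Modal.Modality) (f g : Modal.Term Modal.S5.Prim A B),
        Modal.arrow Modal.S5.Ax f ≠ Modal.arrow Modal.S5.Ax g →
        (∀ i : Fin 6, Modal.SameCategory (Modal.S5.Ext f g) (Modal.S5.Triv i)) ∧
          Quiver.IsThin (Modal.SynCat (Modal.S5.Ext f g))) ∧
    -- the same for `5S`
    ((∀ i : Fin 6, Quiver.IsThin (Modal.SynCat (Modal.FiveS.Triv i))) ∧
      ∀ (A B : Modal.Modality) (f g : Modal.Term Modal.FiveS.Prim A B),
        Modal.arrow Modal.FiveS.Ax f ≠ Modal.arrow Modal.FiveS.Ax g →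
        (∀ i : Fin 6, Modal.SameCategory (Modal.FiveS.Ext f g) (Modal.FiveS.Triv i)) ∧
          Quiver.IsThin (Modal.SynCat (Modal.FiveS.Ext f g))) ∧
    -- trijunctions: a new canonical equation, universally assumed, yields all canonical equations
    (∀ (s t : Modal.Trijunction.Side) (X Y : Modal.Trijunction.Word s t)
        (f g : Modal.Trijunction.Arr X Y),
        ¬ Modal.Trijunction.Derives Modal.Trijunction.Free f g →
        ∀ (s' t' : Modal.Trijunction.Side) (X' Y' : Modal.Trijunction.Word s' t')
          (h k : Modal.Trijunction.Arr X' Y'),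
          Modal.Trijunction.Derives (Modal.Trijunction.Universal f g) h k) := by
  refine ⟨⟨fun i => Modal.isThin_of_derives (Modal.S5.derives_triv i), fun A B f g h => ?_⟩,
    ⟨fun i => Modal.isThin_of_derives (Modal.FiveS.derives_triv i), fun A B f g h => ?_⟩,
    fun s t X Y f g h s' t' X' Y' p q => Modal.Trijunction.derives_universal h p q⟩
  · have key := @Modal.S5.derives_ext_of_not_derives A B f g
      (Modal.S5.not_derives_toArr fun h' => h (Modal.arrow_eq_arrow.2 h'))
    exact ⟨fun i => Modal.sameCategory_of_derives (@key) (Modal.S5.derives_triv i),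
      Modal.isThin_of_derives (@key)⟩
  · have key := @Modal.FiveS.derives_ext_of_not_derives A B f g
      (Modal.FiveS.not_derives_toArr fun h' => h (Modal.arrow_eq_arrow.2 h'))
    exact ⟨fun i => Modal.sameCategory_of_derives (@key) (Modal.FiveS.derives_triv i),
      Modal.isThin_of_derives (@key)⟩
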